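/- **Extension lemma.** Call a poset a *dcpo* if each of its nonempty directed subsets has a supremum (a least element is not required). Let $\mathsf{Nodes}$ be an infinite set of nodes (for example a countably infinite one), and let $\langle L,\le\rangle$ be a dcpo with a least element $\bot$ in which every element has only finitely many elements below it. *LPOFs.* Formulae are built from $\mathsf{true}$, $\mathsf{false}$, $\wedge$, $\vee$, $\neg$ and nodes as Boolean variables; formulae are compared syntactically, while satisfiability and $\Rightarrow$ refer to Boolean valuations of the nodes. For a strict order $<$ write $\mathrm{succ}(x)$, $\mathrm{pred}(x)$ for the immediate successors and predecessors of $x$; a node is minimal if $\mathrm{pred}(x)=\emptyset$; the level of $x$ is the supremum of the $n$ for which there are $x_0,\dots,x_n=x$ with $x_0$ minimal and $x_{i+1}\in\mathrm{succ}(x_i)$. A *labelled partial order with formulae* (LPOF) over $L$ is $\alpha=\langle N,<,\lambda,\varphi\rangle$ where $N\subseteq\mathsf{Nodes}$ is countable; $<$ is a strict partial order on $N$ such that each node has finitely many nodes below it, each level is finite, and there is exactly one minimal node; $\lambda\colon N\to L$ satisfies $\mathrm{succ}(x)=\emptyset$ whenever $\lambda(x)=\bot$; and $\varphi$ assigns to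 each $x\in N$ a satisfiable formula whose variables all lie strictly below $x$, with $\varphi(y)\Rightarrow\varphi(x)$ whenever $x<y$. Write $\alpha\sqsubseteq\beta$ if $N_\alpha$ is a downward closed subset of $N_\beta$, $<_\alpha$ is the restriction of $<_\beta$ to $N_\alpha$, and for all $x\in N_\alpha$: $\lambda_\alpha(x)\le\lambda_\beta(x)$, $\varphi_\alpha(x)=\varphi_\beta(x)$, and $\mathrm{succ}_\alpha(x)=\mathrm{succ}_\beta(x)\setminus\{y \mid z<_\beta y \text{ for some } z\in N_\alpha \text{ with } \lambda_\alpha(z)=\bot\}$. *Pomsets.* A *pomset* (with formulae) is an isomorphism class of LPOFs, where an isomorphism is a bijective renaming of the nodes that carries the order, the labels and the formulae (with variables renamed) of one LPOF to those of the other. $\mathrm{Pom}(L)$ is the set of pomsets, ordered by $A\sqsubseteq B$ iff $\alpha\sqsubseteq\beta$ for some $\alpha\in A$ and $\beta\in B$. $\mathrm{Pom}_{\mathrm{fin}}(L)$ is the set of pomsets with finitely many nodes, with the induced order. For pomsets $A',A$, write $A'\ll A$ if $A'$ is finite and $A'\sqsubseteq A$ (that is, $A'$ is a *finite approximation* of $A$).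 Powers such as $\mathrm{Pom}(L)^n$ carry the componentwise order. *Statement.* Let $\langle T,\le\rangle$ be a dcpo, $n\ge 0$, and let $f\colon \mathrm{Pom}_{\mathrm{fin}}(L)^n\to T$ be monotone. Then $\mathrm{Pom}(L)^n$ is a dcpo, and the function $f^*\colon \mathrm{Pom}(L)^n\to T$, $$f^*(A_1,\dots,A_n)=\sup_{A_1'\ll A_1}\cdots\sup_{A_n'\ll A_n} f(A_1',\dots,A_n'),$$ is well defined (all the iterated suprema exist, and their value is also the joint supremum of $f(A_1',\dots,A_n')$ over all tuples with $A_i'\ll A_i$ for every $i$) and Scott continuous: it is monotone and preserves suprema of nonempty directed sets. -/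

import Mathlib

/-! ### Directed-complete partial orders -/

/-- A directed-complete partial order: every (nonempty) directed set has a supremum.
No bottom element is required. -/
def IsDCPO (X : Type*) [PartialOrder X] : Prop :=
  ∀ D : Set X, D.Nonempty → DirectedOn (· ≤ ·) D → ∃ s, IsLUB D s

/-- Every element has only finitely many elements strictly below it. -/
def FinitelyPreceded (X : Type*) [PartialOrder X] : Prop :=
  ∀ x : X, {y : X | y < x}.Finite

/-! ### Boolean formulae over nodes -/

/-- Boolean formulae whose variables are nodes. -/
inductive NodeForm (V : Type*) where
  | tru : NodeForm V
  | fls : NodeForm V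
  | and : NodeForm V → NodeForm V → NodeForm V
  | or : NodeForm V → NodeForm V → NodeForm V
  | not : NodeForm V → NodeForm V
  | var : V → NodeForm V

namespace NodeForm

variable {V W : Type*}

/-- Satisfaction of a formula by a valuation. -/
def Holds (v : V → Bool) : NodeForm V → Prop
  | tru => True
  | fls => False
  | and a b => Holds v a ∧ Holds v b
  | or a b => Holds v a ∨ Holds v b
  | not a => ¬ Holds v a
  | var x => v x = true

/-- The variables (nodes) that appear in a formula. -/
def free : NodeForm V → Set V
  | tru => ∅
  | fls => ∅
  | and a b => free a ∪ free b
  | or a b => free a ∪ free b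
  | not a => free a
  | var x => {x}

/-- Satisfiability. -/
def Sat (a : NodeForm V) : Prop := ∃ v : V → Bool, Holds v a

/-- Semantic entailment. -/
def Entails (a b : NodeForm V) : Prop := ∀ v : V → Bool, Holds v a → Holds v b

/-- Syntactic renaming of variables. -/
def rename (f : V → W) : NodeForm V → NodeForm W
  | tru => tru
  | fls => fls
  | and a b => and (rename f a) (rename f b)
  | or a b => or (rename f a) (rename f b)
  | not a => not (rename f a)
  | var x => var (f x)

theorem holds_congr {v w : V → Bool} {a : NodeForm V} (h : ∀ x ∈ free a, v x = w x) :
    Holds v a ↔ Holds w a := by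
  induction a with
  | tru => exact Iff.rfl
  | fls => exact Iff.rfl
  | and a b iha ihb =>
    exact and_congr (iha fun x hx => h x (Or.inl hx)) (ihb fun x hx => h x (Or.inr hx))
  | or a b iha ihb =>
    exact or_congr (iha fun x hx => h x (Or.inl hx)) (ihb fun x hx => h x (Or.inr hx))
  | not a iha => exact not_congr (iha h)
  | var x => simp only [Holds, h x (by simp [free])]

theorem holds_rename (f : V → W) (v : W → Bool) (a : NodeForm V) :
    Holds v (rename f a) ↔ Holds (v ∘ f) a := by
  induction a with
  | tru => exact Iff.rfl
  | fls => exact Iff.rfl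
  | and a b iha ihb => exact and_congr iha ihb
  | or a b iha ihb => exact or_congr iha ihb
  | not a iha => exact not_congr iha
  | var x => exact Iff.rfl

theorem free_rename (f : V → W) (a : NodeForm V) : free (rename f a) = f '' free a := by
  induction a with
  | tru => simp [free, rename]
  | fls => simp [free, rename]
  | and a b iha ihb => simp [free, rename, iha, ihb, Set.image_union]
  | or a b iha ihb => simp [free, rename, iha, ihb, Set.image_union]
  | not a iha => simpa [free, rename] using iha
  | var x => simp [free, rename]

theorem rename_congr {f g : V → W} {a : NodeForm V} (h : ∀ x ∈ free a, f x = g x) :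
    rename f a = rename g a := by
  induction a with
  | tru => rfl
  | fls => rfl
  | and a b iha ihb =>
    simp only [rename, iha fun x hx => h x (Or.inl hx), ihb fun x hx => h x (Or.inr hx)]
  | or a b iha ihb =>
    simp only [rename, iha fun x hx => h x (Or.inl hx), ihb fun x hx => h x (Or.inr hx)]
  | not a iha => simp only [rename, iha h]
  | var x => simp only [rename, h x (by simp [free])]

theorem rename_id (a : NodeForm V) : rename id a = a := by
  induction a with
  | tru => rfl
  | fls => rfl
  | and a b iha ihb => simp only [rename, iha, ihb]
  | or a b iha ihb => simp only [rename, iha, ihb]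
  | not a iha => simp only [rename, iha]
  | var x => rfl

theorem rename_rename {U : Type*} (f : V → W) (g : W → U) (a : NodeForm V) :
    rename g (rename f a) = rename (g ∘ f) a := by
  induction a with
  | tru => rfl
  | fls => rfl
  | and a b iha ihb => simp only [rename, iha, ihb]
  | or a b iha ihb => simp only [rename, iha, ihb]
  | not a iha => simp only [rename, iha]
  | var x => rfl

end NodeForm

/-! ### Strict orders on a set of nodes -/

section StrictOrder

variable {V : Type*}

/-- Immediate successors of `x` for the strict order `lt`. -/
def succSet (lt : V → V → Prop) (x : V) : Set V :=
  {y | lt x y ∧ ¬ ∃ z, lt x z ∧ lt z y}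

/-- Immediate predecessors of `x` for the strict order `lt`. -/
def predSet (lt : V → V → Prop) (x : V) : Set V :=
  {y | lt y x ∧ ¬ ∃ z, lt y z ∧ lt z x}

/-- Minimal nodes of `N`: those without immediate predecessors. -/
def minSet (N : Set V) (lt : V → V → Prop) : Set V :=
  {x | x ∈ N ∧ predSet lt x = ∅}

/-- The `n` for which there are `x₀, …, xₙ = x` with `x₀` minimal, each `xᵢ₊₁` an immediate
successor of `xᵢ`. -/
def chainLengths (N : Set V) (lt : V → V → Prop) (x : V) : Set ℕ :=
  {n | ∃ c : ℕ → V, c 0 ∈ minSet N lt ∧ c n = x ∧ ∀ i < n, c (i + 1) ∈ succSet lt (c i)}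

/-- The level of a node (for finitely preceded orders the set of chain lengths is nonempty and
bounded, so that the supremum is a genuine one). -/
noncomputable def level (N : Set V) (lt : V → V → Prop) (x : V) : ℕ :=
  sSup (chainLengths N lt x)

end StrictOrder

/-! ### Labelled partial orders with formulae -/

/-- Labelled partial orders with formulae with nodes in `V` and labels in `L`. The label and
formula functions are given a fixed default value outside the node set, so that two structures
are equal exactly when their components agree on the nodes. -/
structure LPOF (V : Type*) (L : Type*) [PartialOrder L] [OrderBot L] where
  /-- the set of nodes -/
  nodes : Set V
  /-- the strict order, a subset of `nodes × nodes` -/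
  lt : V → V → Prop
  /-- the labelling -/
  label : V → L
  /-- the formula function -/
  form : V → NodeForm V
  nodes_countable : nodes.Countable
  lt_mem : ∀ x y, lt x y → x ∈ nodes ∧ y ∈ nodes
  lt_irrefl : ∀ x, ¬ lt x x
  lt_trans : ∀ x y z, lt x y → lt y z → lt x z
  finitely_preceded : ∀ x ∈ nodes, {y | lt y x}.Finite
  level_finite : ∀ n : ℕ, {x | x ∈ nodes ∧ level nodes lt x = n}.Finite
  single_rooted : ∃! r, r ∈ minSet nodes lt
  succ_of_label_bot : ∀ x ∈ nodes, label x = ⊥ → succSet lt x = ∅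
  form_sat : ∀ x ∈ nodes, (form x).Sat
  form_free : ∀ x ∈ nodes, (form x).free ⊆ {y | lt y x}
  form_entails : ∀ x y, lt x y → (form y).Entails (form x)
  label_default : ∀ x, x ∉ nodes → label x = ⊥
  form_default : ∀ x, x ∉ nodes → form x = NodeForm.tru

namespace LPOF

variable {V : Type*} {L : Type*} [PartialOrder L] [OrderBot L]

/-- The nodes labelled with `⊥`. -/
def botNodes (α : LPOF V L) : Set V := {x | x ∈ α.nodes ∧ α.label x = ⊥}

/-- The nodes that lie strictly above some node of `X`. -/
def above (α : LPOF V L) (X : Set V) : Set V := {y | ∃ x ∈ X, α.lt x y}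

/-- The order on labelled partial orders with formulae: `β` is obtained from `α` by increasing
labels and by expanding nodes labelled with `⊥`. -/
structure Le (α β : LPOF V L) : Prop where
  nodes_subset : α.nodes ⊆ β.nodes
  nodes_down : ∀ x ∈ α.nodes, ∀ y, β.lt y x → y ∈ α.nodes
  lt_iff : ∀ x y, α.lt x y ↔ β.lt x y ∧ x ∈ α.nodes ∧ y ∈ α.nodes
  label_le : ∀ x ∈ α.nodes, α.label x ≤ β.label x
  form_eq : ∀ x ∈ α.nodes, α.form x = β.form x
  succ_eq : ∀ x ∈ α.nodes, succSet α.lt x = succSet β.lt x \ β.above α.botNodes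

theorem eq_of {α β : LPOF V L} (hN : α.nodes = β.nodes) (hlt : ∀ x y, α.lt x y ↔ β.lt x y)
    (hl : ∀ x ∈ α.nodes, α.label x = β.label x) (hf : ∀ x ∈ α.nodes, α.form x = β.form x) :
    α = β := by
  have h1 : α.lt = β.lt := by
    funext x y
    exact propext (hlt x y)
  have h2 : α.label = β.label := by
    funext x
    by_cases hx : x ∈ α.nodes
    · exact hl x hx
    · rw [α.label_default x hx, β.label_default x (hN ▸ hx)]
  have h3 : α.form = β.form := by
    funext x
    by_cases hx : x ∈ α.nodes
    · exact hf x hx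
    · rw [α.form_default x hx, β.form_default x (hN ▸ hx)]
  cases α
  cases β
  simp only at hN h1 h2 h3
  subst hN h1 h2 h3
  rfl

/-! #### Transport along an injection -/

/-- The image of a relation. -/
def mapRel (lt : V → V → Prop) (f : V → V) (u v : V) : Prop :=
  ∃ x y, lt x y ∧ f x = u ∧ f y = v

section MapRel

variable {N : Set V} {lt : V → V → Prop} {f : V → V}

theorem mapRel_iff (hm : ∀ x y, lt x y → x ∈ N ∧ y ∈ N) (hf : Set.InjOn f N) {x y : V}
    (hx : x ∈ N) (hy : y ∈ N) : mapRel lt f (f x) (f y) ↔ lt x y := by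
  constructor
  · rintro ⟨a, b, hab, h1, h2⟩
    rw [← hf (hm _ _ hab).1 hx h1, ← hf (hm _ _ hab).2 hy h2]
    exact hab
  · intro h
    exact ⟨x, y, h, rfl, rfl⟩

theorem mapRel_left (hm : ∀ x y, lt x y → x ∈ N ∧ y ∈ N) (hf : Set.InjOn f N) {x v : V}
    (hx : x ∈ N) : mapRel lt f (f x) v ↔ ∃ y, lt x y ∧ f y = v := by
  constructor
  · rintro ⟨a, b, hab, h1, h2⟩
    rw [hf (hm _ _ hab).1 hx h1] at hab
    exact ⟨b, hab, h2⟩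
  · rintro ⟨y, h, rfl⟩
    exact ⟨x, y, h, rfl, rfl⟩

theorem mapRel_right (hm : ∀ x y, lt x y → x ∈ N ∧ y ∈ N) (hf : Set.InjOn f N) {u y : V}
    (hy : y ∈ N) : mapRel lt f u (f y) ↔ ∃ x, lt x y ∧ f x = u := by
  constructor
  · rintro ⟨a, b, hab, h1, h2⟩
    rw [hf (hm _ _ hab).2 hy h2] at hab
    exact ⟨a, hab, h1⟩
  · rintro ⟨x, h, rfl⟩
    exact ⟨x, y, h, rfl, rfl⟩

theorem succSet_mapRel (hm : ∀ x y, lt x y → x ∈ N ∧ y ∈ N) (hf : Set.InjOn f N) {x : V}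
    (hx : x ∈ N) : succSet (mapRel lt f) (f x) = f '' succSet lt x := by
  ext v
  constructor
  · rintro ⟨h1, h2⟩
    obtain ⟨y, hxy, rfl⟩ := (mapRel_left hm hf hx).1 h1
    refine ⟨y, ⟨hxy, ?_⟩, rfl⟩
    rintro ⟨z, hz1, hz2⟩
    exact h2 ⟨f z, ⟨x, z, hz1, rfl, rfl⟩, ⟨z, y, hz2, rfl, rfl⟩⟩
  · rintro ⟨y, ⟨hxy, h2⟩, rfl⟩
    refine ⟨⟨x, y, hxy, rfl, rfl⟩, ?_⟩
    rintro ⟨w, hw1, hw2⟩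
    obtain ⟨z, hxz, rfl⟩ := (mapRel_left hm hf hx).1 hw1
    exact h2 ⟨z, hxz, (mapRel_iff hm hf (hm _ _ hxz).2 (hm _ _ hxy).2).1 hw2⟩

theorem predSet_mapRel (hm : ∀ x y, lt x y → x ∈ N ∧ y ∈ N) (hf : Set.InjOn f N) {x : V}
    (hx : x ∈ N) : predSet (mapRel lt f) (f x) = f '' predSet lt x := by
  ext v
  constructor
  · rintro ⟨h1, h2⟩
    obtain ⟨y, hxy, rfl⟩ := (mapRel_right hm hf hx).1 h1
    refine ⟨y, ⟨hxy, ?_⟩, rfl⟩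
    rintro ⟨z, hz1, hz2⟩
    exact h2 ⟨f z, ⟨y, z, hz1, rfl, rfl⟩, ⟨z, x, hz2, rfl, rfl⟩⟩
  · rintro ⟨y, ⟨hxy, h2⟩, rfl⟩
    refine ⟨⟨y, x, hxy, rfl, rfl⟩, ?_⟩
    rintro ⟨w, hw1, hw2⟩
    obtain ⟨z, hxz, rfl⟩ := (mapRel_right hm hf hx).1 hw2
    exact h2 ⟨z, (mapRel_iff hm hf (hm _ _ hxy).1 (hm _ _ hxz).1).1 hw1, hxz⟩

theorem minSet_mapRel (hm : ∀ x y, lt x y → x ∈ N ∧ y ∈ N) (hf : Set.InjOn f N) :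
    minSet (f '' N) (mapRel lt f) = f '' minSet N lt := by
  ext u
  constructor
  · rintro ⟨⟨x, hx, rfl⟩, h⟩
    refine ⟨x, ⟨hx, ?_⟩, rfl⟩
    rw [predSet_mapRel hm hf hx] at h
    exact Set.image_eq_empty.1 h
  · rintro ⟨x, ⟨hx, h⟩, rfl⟩
    refine ⟨⟨x, hx, rfl⟩, ?_⟩
    rw [predSet_mapRel hm hf hx, h, Set.image_empty]

theorem level_mapRel (hm : ∀ x y, lt x y → x ∈ N ∧ y ∈ N) (hf : Set.InjOn f N) {x : V}
    (hx : x ∈ N) : level (f '' N) (mapRel lt f) (f x) = level N lt x := by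
  unfold level
  congr 1
  ext n
  constructor
  · rintro ⟨c, h0, hn, hs⟩
    have hmem : ∀ i ≤ n, c i ∈ f '' N := by
      intro i
      induction i with
      | zero => exact fun _ => h0.1
      | succ i _ =>
        intro hi
        obtain ⟨a, b, hab, _, h2⟩ := (hs i hi).1
        exact ⟨b, (hm _ _ hab).2, h2⟩
    have hex : ∀ i, ∃ y, i ≤ n → y ∈ N ∧ f y = c i := by
      intro i
      by_cases hi : i ≤ n
      · obtain ⟨y, hy, h⟩ := hmem i hi
        exact ⟨y, fun _ => ⟨hy, h⟩⟩
      · exact ⟨x, fun h => absurd h hi⟩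
    choose d hd using hex
    refine ⟨d, ?_, ?_, ?_⟩
    · rw [minSet_mapRel hm hf] at h0
      obtain ⟨y, hy, h⟩ := h0
      rw [hf (hd 0 n.zero_le).1 hy.1 ((hd 0 n.zero_le).2.trans h.symm)]
      exact hy
    · exact hf (hd n le_rfl).1 hx ((hd n le_rfl).2.trans hn)
    · intro i hi
      have h := hs i hi
      rw [← (hd i hi.le).2, succSet_mapRel hm hf (hd i hi.le).1] at h
      obtain ⟨y, hy, hy2⟩ := h
      rw [hf (hd (i + 1) hi).1 (hm _ _ hy.1).2 ((hd (i + 1) hi).2.trans hy2.symm)]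
      exact hy
  · rintro ⟨c, h0, hn, hs⟩
    refine ⟨fun i => f (c i), ?_, by simp only [hn], ?_⟩
    · rw [minSet_mapRel hm hf]
      exact ⟨c 0, h0, rfl⟩
    · intro i hi
      have h := hs i hi
      simp only
      rw [succSet_mapRel hm hf (hm _ _ h.1).1]
      exact ⟨_, h, rfl⟩

end MapRel

open Classical in
/-- The structure `f(α)` obtained by renaming the nodes of `α` along `f`, which has to be
injective on the nodes of `α`. -/
noncomputable def rename (α : LPOF V L) (f : V → V) (hf : Set.InjOn f α.nodes) : LPOF V L :=
  let label' : V → L := fun u => if h : ∃ x ∈ α.nodes, f x = u then α.label h.choose else ⊥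
  let form' : V → NodeForm V := fun u =>
    if h : ∃ x ∈ α.nodes, f x = u then (α.form h.choose).rename f else NodeForm.tru
  have hlabel : ∀ x ∈ α.nodes, label' (f x) = α.label x := by
    intro x hx
    have h : ∃ y ∈ α.nodes, f y = f x := ⟨x, hx, rfl⟩
    simp only [label', dif_pos h]
    rw [hf h.choose_spec.1 hx h.choose_spec.2]
  have hform : ∀ x ∈ α.nodes, form' (f x) = (α.form x).rename f := by
    intro x hx
    have h : ∃ y ∈ α.nodes, f y = f x := ⟨x, hx, rfl⟩
    simp only [form', dif_pos h]
    rw [hf h.choose_spec.1 hx h.choose_spec.2]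
  { nodes := f '' α.nodes
    lt := mapRel α.lt f
    label := label'
    form := form'
    nodes_countable := α.nodes_countable.image f
    lt_mem := by
      rintro u v ⟨x, y, h, rfl, rfl⟩
      exact ⟨⟨x, (α.lt_mem _ _ h).1, rfl⟩, ⟨y, (α.lt_mem _ _ h).2, rfl⟩⟩
    lt_irrefl := by
      rintro u ⟨x, y, h, rfl, h2⟩
      have h3 := hf (α.lt_mem _ _ h).2 (α.lt_mem _ _ h).1 h2
      rw [h3] at h
      exact α.lt_irrefl _ h
    lt_trans := by
      rintro u v w ⟨x, y, h, rfl, rfl⟩ h2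
      obtain ⟨z, hz, rfl⟩ := (mapRel_left α.lt_mem hf (α.lt_mem _ _ h).2).1 h2
      exact ⟨x, z, α.lt_trans _ _ _ h hz, rfl, rfl⟩
    finitely_preceded := by
      rintro u ⟨x, hx, rfl⟩
      refine ((α.finitely_preceded x hx).image f).subset ?_
      intro v hv
      obtain ⟨y, hy, rfl⟩ := (mapRel_right α.lt_mem hf hx).1 hv
      exact ⟨y, hy, rfl⟩
    level_finite := by
      intro n
      refine ((α.level_finite n).image f).subset ?_
      rintro u ⟨⟨x, hx, rfl⟩, hl⟩
      rw [level_mapRel α.lt_mem hf hx] at hl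
      exact ⟨x, ⟨hx, hl⟩, rfl⟩
    single_rooted := by
      obtain ⟨r, hr, hu⟩ := α.single_rooted
      rw [minSet_mapRel α.lt_mem hf]
      refine ⟨f r, ⟨r, hr, rfl⟩, ?_⟩
      rintro _ ⟨s, hs, rfl⟩
      rw [hu s hs]
    succ_of_label_bot := by
      rintro u ⟨x, hx, rfl⟩ hl
      rw [hlabel x hx] at hl
      rw [succSet_mapRel α.lt_mem hf hx, α.succ_of_label_bot x hx hl, Set.image_empty]
    form_sat := by
      rintro u ⟨x, hx, rfl⟩
      rw [hform x hx]
      obtain ⟨v, hv⟩ := α.form_sat x hx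
      have : Nonempty V := ⟨x⟩
      refine ⟨v ∘ Function.invFunOn f α.nodes, ?_⟩
      rw [NodeForm.holds_rename]
      refine (NodeForm.holds_congr ?_).1 hv
      intro y hy
      have hyN : y ∈ α.nodes := (α.lt_mem _ _ (α.form_free x hx hy)).1
      simp only [Function.comp]
      rw [hf.leftInvOn_invFunOn hyN]
    form_free := by
      rintro u ⟨x, hx, rfl⟩
      rw [hform x hx, NodeForm.free_rename]
      rintro _ ⟨y, hy, rfl⟩
      exact ⟨y, x, α.form_free x hx hy, rfl, rfl⟩
    form_entails := by
      rintro u v ⟨x, y, h, rfl, rfl⟩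
      rw [hform x (α.lt_mem _ _ h).1, hform y (α.lt_mem _ _ h).2]
      intro w hw
      rw [NodeForm.holds_rename] at hw ⊢
      exact α.form_entails x y h _ hw
    label_default := by
      intro u hu
      exact dif_neg hu
    form_default := by
      intro u hu
      exact dif_neg hu }

theorem rename_label (α : LPOF V L) {f : V → V} (hf : Set.InjOn f α.nodes) {x : V}
    (hx : x ∈ α.nodes) : (α.rename f hf).label (f x) = α.label x := by
  have h : ∃ y ∈ α.nodes, f y = f x := ⟨x, hx, rfl⟩
  simp only [rename, dif_pos h]
  rw [hf h.choose_spec.1 hx h.choose_spec.2]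

theorem rename_form (α : LPOF V L) {f : V → V} (hf : Set.InjOn f α.nodes) {x : V}
    (hx : x ∈ α.nodes) : (α.rename f hf).form (f x) = (α.form x).rename f := by
  have h : ∃ y ∈ α.nodes, f y = f x := ⟨x, hx, rfl⟩
  simp only [rename, dif_pos h]
  rw [hf h.choose_spec.1 hx h.choose_spec.2]

theorem rename_nodes (α : LPOF V L) {f : V → V} (hf : Set.InjOn f α.nodes) :
    (α.rename f hf).nodes = f '' α.nodes := rfl

theorem rename_lt (α : LPOF V L) {f : V → V} (hf : Set.InjOn f α.nodes) :
    (α.rename f hf).lt = mapRel α.lt f := rfl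

/-- Isomorphism: `β = f(α)` for some `f` that maps the nodes of `α` bijectively to those
of `β`. -/
def Iso (α β : LPOF V L) : Prop :=
  ∃ (f : V → V) (hf : Set.InjOn f α.nodes), α.rename f hf = β

theorem form_free_nodes (α : LPOF V L) {x : V} (hx : x ∈ α.nodes) :
    (α.form x).free ⊆ α.nodes :=
  fun _ hy => (α.lt_mem _ _ (α.form_free x hx hy)).1

theorem rename_eq_self (α : LPOF V L) {f : V → V} (hf : Set.InjOn f α.nodes)
    (h : ∀ x ∈ α.nodes, f x = x) : α.rename f hf = α := by
  have hN : (α.rename f hf).nodes = α.nodes := by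
    rw [rename_nodes, Set.image_congr h, Set.image_id']
  refine eq_of hN ?_ ?_ ?_
  · intro x y
    constructor
    · rintro ⟨a, b, hab, rfl, rfl⟩
      rw [h a (α.lt_mem _ _ hab).1, h b (α.lt_mem _ _ hab).2]
      exact hab
    · intro hab
      exact ⟨x, y, hab, h x (α.lt_mem _ _ hab).1, h y (α.lt_mem _ _ hab).2⟩
  · intro x hx
    rw [hN] at hx
    have := α.rename_label hf hx
    rwa [h x hx] at this
  · intro x hx
    rw [hN] at hx
    have := α.rename_form hf hx
    rw [h x hx] at this
    rw [this, NodeForm.rename_congr (g := id) fun y hy => h y (α.form_free_nodes hx hy),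
      NodeForm.rename_id]

theorem rename_rename (α : LPOF V L) {f g : V → V} (hf : Set.InjOn f α.nodes)
    (hg : Set.InjOn g (α.rename f hf).nodes) (hgf : Set.InjOn (g ∘ f) α.nodes) :
    (α.rename f hf).rename g hg = α.rename (g ∘ f) hgf := by
  refine eq_of ?_ ?_ ?_ ?_
  · rw [rename_nodes, rename_nodes, rename_nodes, Set.image_comp]
  · intro x y
    constructor
    · rintro ⟨_, _, ⟨a, b, hab, rfl, rfl⟩, rfl, rfl⟩
      exact ⟨a, b, hab, rfl, rfl⟩
    · rintro ⟨a, b, hab, rfl, rfl⟩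
      exact ⟨_, _, ⟨a, b, hab, rfl, rfl⟩, rfl, rfl⟩
  · rintro _ ⟨_, ⟨x, hx, rfl⟩, rfl⟩
    rw [rename_label _ hg ⟨x, hx, rfl⟩, rename_label _ hf hx]
    exact (α.rename_label hgf hx).symm
  · rintro _ ⟨_, ⟨x, hx, rfl⟩, rfl⟩
    rw [rename_form _ hg ⟨x, hx, rfl⟩, rename_form _ hf hx, NodeForm.rename_rename]
    exact (α.rename_form hgf hx).symm

theorem Iso.refl (α : LPOF V L) : Iso α α :=
  ⟨id, Set.injOn_id _, α.rename_eq_self _ fun _ _ => rfl⟩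

theorem Iso.symm {α β : LPOF V L} : Iso α β → Iso β α := by
  rintro ⟨f, hf, rfl⟩
  obtain ⟨r, hr, -⟩ := α.single_rooted
  have : Nonempty V := ⟨r⟩
  have hl := hf.leftInvOn_invFunOn
  have hg : Set.InjOn (Function.invFunOn f α.nodes) (α.rename f hf).nodes := by
    rintro _ ⟨x, hx, rfl⟩ _ ⟨y, hy, rfl⟩ h
    rw [hl hx, hl hy] at h
    rw [h]
  have hgf : Set.InjOn (Function.invFunOn f α.nodes ∘ f) α.nodes := by
    intro x hx y hy h
    simp only [Function.comp] at h
    rwa [hl hx, hl hy] at h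
  refine ⟨Function.invFunOn f α.nodes, hg, ?_⟩
  rw [rename_rename α hf hg hgf]
  exact α.rename_eq_self _ fun x hx => hl hx

theorem Iso.trans {α β γ : LPOF V L} : Iso α β → Iso β γ → Iso α γ := by
  rintro ⟨f, hf, rfl⟩ ⟨g, hg, rfl⟩
  have hgf : Set.InjOn (g ∘ f) α.nodes := by
    intro x hx y hy h
    exact hf hx hy (hg ⟨x, hx, rfl⟩ ⟨y, hy, rfl⟩ h)
  exact ⟨g ∘ f, hgf, (rename_rename α hf hg hgf).symm⟩

/-- The setoid of isomorphism. -/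
instance setoid (V : Type*) (L : Type*) [PartialOrder L] [OrderBot L] : Setoid (LPOF V L) where
  r := Iso
  iseqv := ⟨Iso.refl, Iso.symm, Iso.trans⟩

/-! #### The order is a partial order, compatible with renaming -/

theorem Le.rename {α β : LPOF V L} (h : Le α β) {f : V → V} (hβ : Set.InjOn f β.nodes)
    (hα : Set.InjOn f α.nodes) : Le (α.rename f hα) (β.rename f hβ) where
  nodes_subset := Set.image_mono h.nodes_subset
  nodes_down := by
    rintro _ ⟨x, hx, rfl⟩ v hv
    obtain ⟨y, hy, rfl⟩ := (mapRel_right β.lt_mem hβ (h.nodes_subset hx)).1 hv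
    exact ⟨y, h.nodes_down x hx y hy, rfl⟩
  lt_iff := by
    intro u v
    constructor
    · rintro ⟨x, y, hxy, rfl, rfl⟩
      have := (h.lt_iff x y).1 hxy
      exact ⟨⟨x, y, this.1, rfl, rfl⟩, ⟨x, this.2.1, rfl⟩, ⟨y, this.2.2, rfl⟩⟩
    · rintro ⟨h1, ⟨x, hx, rfl⟩, ⟨y, hy, rfl⟩⟩
      have := (mapRel_iff β.lt_mem hβ (h.nodes_subset hx) (h.nodes_subset hy)).1 h1
      exact ⟨x, y, (h.lt_iff x y).2 ⟨this, hx, hy⟩, rfl, rfl⟩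
  label_le := by
    rintro _ ⟨x, hx, rfl⟩
    rw [rename_label α hα hx, rename_label β hβ (h.nodes_subset hx)]
    exact h.label_le x hx
  form_eq := by
    rintro _ ⟨x, hx, rfl⟩
    rw [rename_form α hα hx, rename_form β hβ (h.nodes_subset hx), h.form_eq x hx]
  succ_eq := by
    rintro _ ⟨x, hx, rfl⟩
    rw [rename_lt, rename_lt, succSet_mapRel α.lt_mem hα hx,
      succSet_mapRel β.lt_mem hβ (h.nodes_subset hx), h.succ_eq x hx]
    ext v
    constructor
    · rintro ⟨y, ⟨hy1, hy2⟩, rfl⟩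
      refine ⟨⟨y, hy1, rfl⟩, ?_⟩
      rintro ⟨_, ⟨⟨z, hz, rfl⟩, hzb⟩, hzy⟩
      rw [rename_label α hα hz] at hzb
      exact hy2 ⟨z, ⟨hz, hzb⟩, (mapRel_iff β.lt_mem hβ (h.nodes_subset hz)
        (β.lt_mem _ _ hy1.1).2).1 hzy⟩
    · rintro ⟨⟨y, hy1, rfl⟩, hy2⟩
      refine ⟨y, ⟨hy1, ?_⟩, rfl⟩
      rintro ⟨z, ⟨hz, hzb⟩, hzy⟩
      exact hy2 ⟨f z, ⟨⟨z, hz, rfl⟩, (rename_label α hα hz).trans hzb⟩, ⟨z, y, hzy, rfl, rfl⟩⟩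

theorem exists_immediate_pred (α : LPOF V L) {x y : V} (h : α.lt x y) :
    ∃ z, α.lt z y ∧ ¬ ∃ w, α.lt z w ∧ α.lt w y := by
  have hfin := α.finitely_preceded y (α.lt_mem _ _ h).2
  by_contra hne
  push Not at hne
  have hstep : ∀ s : {z | α.lt z y}, ∃ t : {z | α.lt z y}, α.lt s t := by
    rintro ⟨z, hz⟩
    obtain ⟨w, hzw, hwy⟩ := hne z hz
    exact ⟨⟨w, hwy⟩, hzw⟩
  choose g hg using hstep
  have : Finite {z | α.lt z y} := hfin
  have hlt : ∀ (s : {z | α.lt z y}) (m n : ℕ), m < n → α.lt (g^[m] s) (g^[n] s) := by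
    intro s m n hmn
    induction n with
    | zero => omega
    | succ n ih =>
      rw [Function.iterate_succ_apply']
      rcases Nat.lt_succ_iff_lt_or_eq.1 hmn with h1 | h1
      · exact α.lt_trans _ _ _ (ih h1) (hg _)
      · subst h1
        exact hg _
  obtain ⟨m, n, hmn, heq⟩ :=
    Finite.exists_ne_map_eq_of_infinite (fun n : ℕ => g^[n] (⟨x, h⟩ : {z | α.lt z y}))
  rcases lt_or_gt_of_ne hmn with h1 | h1
  · have := hlt ⟨x, h⟩ m n h1
    rw [heq] at this
    exact α.lt_irrefl _ this
  · have := hlt ⟨x, h⟩ n m h1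
    rw [heq] at this
    exact α.lt_irrefl _ this

theorem lt_induction (α : LPOF V L) {P : V → Prop}
    (ih : ∀ x ∈ α.nodes, (∀ y, α.lt y x → P y) → P x) : ∀ x ∈ α.nodes, P x := by
  have key : ∀ n : ℕ, ∀ x ∈ α.nodes, {y | α.lt y x}.ncard < n → P x := by
    intro n
    induction n with
    | zero => intro x _ h; omega
    | succ n ihn =>
      intro x hx hn
      refine ih x hx fun y hy => ihn y (α.lt_mem _ _ hy).1 ?_
      have hss : {z | α.lt z y} ⊂ {z | α.lt z x} :=
        ⟨fun z hz => α.lt_trans _ _ _ hz hy, fun hc => α.lt_irrefl y (hc hy)⟩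
      have := Set.ncard_lt_ncard hss (α.finitely_preceded x hx)
      omega
  exact fun x hx => key _ x hx (Nat.lt_succ_self _)

theorem pred_eq_empty_iff (α : LPOF V L) (x : V) :
    predSet α.lt x = ∅ ↔ ∀ y, ¬ α.lt y x := by
  constructor
  · intro h y hy
    obtain ⟨z, hz⟩ := α.exists_immediate_pred hy
    have : z ∈ predSet α.lt x := hz
    rw [h] at this
    exact this
  · intro h
    ext y
    exact ⟨fun hy => h y hy.1, fun hy => hy.elim⟩

theorem Le.minSet_eq {α β : LPOF V L} (h : Le α β) :
    minSet α.nodes α.lt = minSet β.nodes β.lt := by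
  have hsub : minSet α.nodes α.lt ⊆ minSet β.nodes β.lt := by
    rintro x ⟨hx, hp⟩
    refine ⟨h.nodes_subset hx, ?_⟩
    rw [pred_eq_empty_iff] at hp ⊢
    intro y hy
    exact hp y ((h.lt_iff y x).2 ⟨hy, h.nodes_down x hx y hy, hx⟩)
  refine hsub.antisymm ?_
  intro x hx
  obtain ⟨r, hr, -⟩ := α.single_rooted
  obtain ⟨s, hs, hu⟩ := β.single_rooted
  rw [hu x hx, ← hu r (hsub hr)]
  exact hr

theorem Le.exists_bot_lt {α β : LPOF V L} (h : Le α β) :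
    ∀ x ∈ β.nodes, x ∉ α.nodes → x ∈ β.above α.botNodes := by
  refine β.lt_induction ?_
  intro x hx ih hxα
  by_cases hp : predSet β.lt x = ∅
  · have : x ∈ minSet β.nodes β.lt := ⟨hx, hp⟩
    rw [← h.minSet_eq] at this
    exact absurd this.1 hxα
  · obtain ⟨y, hy⟩ := Set.nonempty_iff_ne_empty.2 hp
    by_cases hyα : y ∈ α.nodes
    · by_contra hab
      have hxs : x ∈ succSet β.lt y \ β.above α.botNodes := ⟨hy, hab⟩
      rw [← h.succ_eq y hyα] at hxs
      exact hxα (α.lt_mem _ _ hxs.1).2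
    · obtain ⟨z, hz, hzy⟩ := ih y hy.1 hyα
      exact ⟨z, hz, β.lt_trans _ _ _ hzy hy.1⟩

theorem bot_not_lt (α : LPOF V L) {x y : V} (hx : x ∈ α.botNodes) : ¬ α.lt x y := by
  revert y
  have hs := α.succ_of_label_bot x hx.1 hx.2
  have key : ∀ y ∈ α.nodes, ¬ α.lt x y := by
    refine α.lt_induction ?_
    intro y _ ih hxy
    by_cases hz : ∃ z, α.lt x z ∧ α.lt z y
    · obtain ⟨z, h1, h2⟩ := hz
      exact ih z h2 h1
    · have : y ∈ succSet α.lt x := ⟨hxy, hz⟩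
      rw [hs] at this
      exact this
  exact fun {y} hxy => key y (α.lt_mem _ _ hxy).2 hxy

theorem Le.mem_iff {α β : LPOF V L} (h : Le α β) {x : V} (hx : x ∈ β.nodes) :
    x ∈ β.above α.botNodes ↔ x ∉ α.nodes := by
  constructor
  · rintro ⟨z, hz, hzx⟩ hxα
    exact α.bot_not_lt hz ((h.lt_iff z x).2 ⟨hzx, hz.1, hxα⟩)
  · exact h.exists_bot_lt x hx

theorem Le.refl (α : LPOF V L) : Le α α where
  nodes_subset := subset_rfl
  nodes_down := fun _ _ y hy => (α.lt_mem _ _ hy).1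
  lt_iff := fun x y => ⟨fun h => ⟨h, α.lt_mem _ _ h⟩, fun h => h.1⟩
  label_le := fun _ _ => le_rfl
  form_eq := fun _ _ => rfl
  succ_eq := by
    intro x _
    ext y
    refine ⟨fun hy => ⟨hy, ?_⟩, fun hy => hy.1⟩
    rintro ⟨z, hz, hzy⟩
    exact α.bot_not_lt hz hzy

theorem Le.trans {α β γ : LPOF V L} (h : Le α β) (k : Le β γ) : Le α γ where
  nodes_subset := h.nodes_subset.trans k.nodes_subset
  nodes_down := by
    intro x hx y hy
    have hyβ := k.nodes_down x (h.nodes_subset hx) y hy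
    exact h.nodes_down x hx y ((k.lt_iff y x).2 ⟨hy, hyβ, h.nodes_subset hx⟩)
  lt_iff := by
    intro x y
    rw [h.lt_iff, k.lt_iff]
    constructor
    · rintro ⟨⟨h1, -⟩, h2⟩
      exact ⟨h1, h2⟩
    · rintro ⟨h1, h2⟩
      exact ⟨⟨h1, h.nodes_subset h2.1, h.nodes_subset h2.2⟩, h2⟩
  label_le := fun x hx => (h.label_le x hx).trans (k.label_le x (h.nodes_subset hx))
  form_eq := fun x hx => (h.form_eq x hx).trans (k.form_eq x (h.nodes_subset hx))
  succ_eq := by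
    intro x hx
    rw [h.succ_eq x hx, k.succ_eq x (h.nodes_subset hx)]
    ext y
    constructor
    · rintro ⟨⟨h1, h2⟩, h3⟩
      refine ⟨h1, ?_⟩
      have hyγ := (γ.lt_mem _ _ h1.1).2
      rw [k.mem_iff hyγ, not_not] at h2
      rw [h.mem_iff h2, not_not] at h3
      rintro ⟨z, hz, hzy⟩
      have hzy' := (k.lt_iff z y).2 ⟨hzy, h.nodes_subset hz.1, h2⟩
      exact α.bot_not_lt hz ((h.lt_iff z y).2 ⟨hzy', hz.1, h3⟩)
    · rintro ⟨h1, h2⟩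
      have hyγ := (γ.lt_mem _ _ h1.1).2
      have hyβ : y ∈ β.nodes := by
        by_contra hyβ
        obtain ⟨z, hz, hzy⟩ := k.exists_bot_lt y hyγ hyβ
        by_cases hzα : z ∈ α.nodes
        · refine h2 ⟨z, ⟨hzα, le_bot_iff.1 ?_⟩, hzy⟩
          rw [← hz.2]
          exact h.label_le z hzα
        · obtain ⟨w, hw, hwz⟩ := h.exists_bot_lt z hz.1 hzα
          exact h2 ⟨w, hw, γ.lt_trans _ _ _ ((k.lt_iff w z).1 hwz).1 hzy⟩
      refine ⟨⟨h1, ?_⟩, ?_⟩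
      · rw [k.mem_iff hyγ, not_not]
        exact hyβ
      · rintro ⟨z, hz, hzy⟩
        exact h2 ⟨z, hz, ((k.lt_iff z y).1 hzy).1⟩

theorem Le.antisymm {α β : LPOF V L} (h : Le α β) (k : Le β α) : α = β := by
  refine eq_of (h.nodes_subset.antisymm k.nodes_subset) ?_ ?_ h.form_eq
  · intro x y
    exact ⟨fun hxy => ((h.lt_iff x y).1 hxy).1, fun hxy => ((k.lt_iff x y).1 hxy).1⟩
  · intro x hx
    exact (h.label_le x hx).antisymm (k.label_le x (h.nodes_subset hx))

/-- Labelled partial orders with formulae form a partial order. -/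
instance partialOrder (V : Type*) (L : Type*) [PartialOrder L] [OrderBot L] :
    PartialOrder (LPOF V L) where
  le := Le
  le_refl := Le.refl
  le_trans := fun _ _ _ => Le.trans
  le_antisymm := fun _ _ => Le.antisymm

theorem Le.succ_iff {α β : LPOF V L} (h : Le α β) {x y : V} (hy : y ∈ α.nodes) :
    y ∈ succSet α.lt x ↔ y ∈ succSet β.lt x := by
  constructor
  · rintro ⟨h1, h2⟩
    refine ⟨((h.lt_iff x y).1 h1).1, ?_⟩
    rintro ⟨z, hz1, hz2⟩
    have hz := h.nodes_down y hy z hz2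
    exact h2 ⟨z, (h.lt_iff _ _).2 ⟨hz1, (α.lt_mem _ _ h1).1, hz⟩, (h.lt_iff _ _).2 ⟨hz2, hz, hy⟩⟩
  · rintro ⟨h1, h2⟩
    refine ⟨(h.lt_iff x y).2 ⟨h1, h.nodes_down y hy x h1, hy⟩, ?_⟩
    rintro ⟨z, hz1, hz2⟩
    exact h2 ⟨z, ((h.lt_iff _ _).1 hz1).1, ((h.lt_iff _ _).1 hz2).1⟩

theorem Le.level_eq {α β : LPOF V L} (h : Le α β) {x : V} (hx : x ∈ α.nodes) :
    level α.nodes α.lt x = level β.nodes β.lt x := by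
  unfold level
  congr 1
  ext n
  constructor
  · rintro ⟨c, h0, hn, hs⟩
    refine ⟨c, h.minSet_eq ▸ h0, hn, fun i hi => ?_⟩
    exact (h.succ_iff (α.lt_mem _ _ (hs i hi).1).2).1 (hs i hi)
  · rintro ⟨c, h0, hn, hs⟩
    have hmem : ∀ k ≤ n, c (n - k) ∈ α.nodes := by
      intro k
      induction k with
      | zero =>
        intro _
        rw [Nat.sub_zero, hn]
        exact hx
      | succ k ih =>
        intro hk
        have h1 := hs (n - (k + 1)) (by omega)
        rw [show n - (k + 1) + 1 = n - k by omega] at h1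
        exact h.nodes_down _ (ih (by omega)) _ h1.1
    refine ⟨c, h.minSet_eq ▸ h0, hn, fun i hi => ?_⟩
    have h1 := hmem (n - (i + 1)) (by omega)
    rw [show n - (n - (i + 1)) = i + 1 by omega] at h1
    exact (h.succ_iff h1).2 (hs i hi)

theorem Le.eq_of_iso {α β γ : LPOF V L} (h : Le α β) (k : Le β γ) (e : Iso α γ) : α = β := by
  obtain ⟨f, hf, rfl⟩ := e
  have hk := h.trans k
  have hfl : ∀ x ∈ α.nodes, f x ∈ (α.rename f hf).nodes ∧
      level (α.rename f hf).nodes (α.rename f hf).lt (f x) = level α.nodes α.lt x :=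
    fun x hx => ⟨⟨x, hx, rfl⟩, level_mapRel α.lt_mem hf hx⟩
  -- at each level the three structures have the same nodes
  have hlev : ∀ n : ℕ, {x | x ∈ α.nodes ∧ level α.nodes α.lt x = n} =
      {x | x ∈ (α.rename f hf).nodes ∧
        level (α.rename f hf).nodes (α.rename f hf).lt x = n} := by
    intro n
    have himg : {x | x ∈ (α.rename f hf).nodes ∧
        level (α.rename f hf).nodes (α.rename f hf).lt x = n} =
        f '' {x | x ∈ α.nodes ∧ level α.nodes α.lt x = n} := by
      ext u
      constructor
      · rintro ⟨⟨x, hx, rfl⟩, hl⟩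
        rw [(hfl x hx).2] at hl
        exact ⟨x, ⟨hx, hl⟩, rfl⟩
      · rintro ⟨x, ⟨hx, hl⟩, rfl⟩
        exact ⟨(hfl x hx).1, (hfl x hx).2.trans hl⟩
    refine Set.eq_of_subset_of_ncard_le ?_ ?_ ((α.rename f hf).level_finite n)
    · rintro x ⟨hx, hl⟩
      exact ⟨hk.nodes_subset hx, (hk.level_eq hx).symm.trans hl⟩
    · rw [himg]
      exact Set.ncard_image_le (α.level_finite n)
  have hN : (α.rename f hf).nodes ⊆ α.nodes := by
    intro x hx
    have : x ∈ {y | y ∈ (α.rename f hf).nodes ∧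
      level (α.rename f hf).nodes (α.rename f hf).lt y =
        level (α.rename f hf).nodes (α.rename f hf).lt x} := ⟨hx, rfl⟩
    rw [← hlev] at this
    exact this.1
  have hmaps : ∀ x ∈ α.nodes, f x ∈ α.nodes := fun x hx => hN ⟨x, hx, rfl⟩
  have hlab : ∀ x ∈ α.nodes, (α.rename f hf).label x ≤ α.label x := by
    intro x hx
    let S : Set V := {y | y ∈ α.nodes ∧ level α.nodes α.lt y = level α.nodes α.lt x}
    have hS : Set.MapsTo f S S := by
      rintro y ⟨hy, hl⟩
      refine ⟨hmaps y hy, ?_⟩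
      rw [hk.level_eq (hmaps y hy), (hfl y hy).2, hl]
    have : Finite S := α.level_finite _
    have hinj : Function.Injective (hS.restrict f S S) := by
      intro a b hab
      exact Subtype.ext (hf a.2.1 b.2.1 (congrArg Subtype.val hab))
    obtain ⟨n, hn, hper⟩ := Function.mem_periodicPts.1
      (hinj.mem_periodicPts (⟨x, hx, rfl⟩ : S))
    have hval : ∀ m, ((hS.restrict f S S)^[m] ⟨x, hx, rfl⟩ : S).1 = f^[m] x := by
      intro m
      induction m with
      | zero => rfl
      | succ m ih =>
        rw [Function.iterate_succ_apply', Function.iterate_succ_apply', ← ih]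
        rfl
    have hmemS : ∀ m, f^[m] x ∈ α.nodes := fun m => by
      rw [← hval m]
      exact ((hS.restrict f S S)^[m] ⟨x, hx, rfl⟩ : S).2.1
    have hdesc : ∀ m, (α.rename f hf).label (f^[m + 1] x) ≤ α.label x := by
      intro m
      induction m with
      | zero => exact (rename_label α hf hx).le
      | succ m ih =>
        rw [Function.iterate_succ_apply', rename_label α hf (hmemS (m + 1))]
        exact (hk.label_le _ (hmemS (m + 1))).trans ih
    have hfix : f^[n] x = x := by
      rw [← hval n, hper.eq]
    have := hdesc (n - 1)
    rwa [Nat.sub_add_cancel hn, hfix] at this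
  refine h.antisymm ?_
  have hNβ : β.nodes = α.nodes := (k.nodes_subset.trans hN).antisymm h.nodes_subset
  refine ⟨hNβ.subset, ?_, ?_, ?_, ?_, ?_⟩
  · intro x _ y hy
    rw [hNβ]
    exact (α.lt_mem _ _ hy).1
  · intro x y
    rw [h.lt_iff, hNβ]
    constructor
    · intro hxy
      have := β.lt_mem _ _ hxy
      rw [hNβ] at this
      exact ⟨⟨hxy, this⟩, this⟩
    · exact fun hxy => hxy.1.1
  · intro x hx
    exact (k.label_le x hx).trans (hlab x (hNβ ▸ hx))
  · intro x hx
    exact (h.form_eq x (hNβ ▸ hx)).symm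
  · intro x hx
    ext y
    constructor
    · intro hy
      have hyβ := (β.lt_mem _ _ hy.1).2
      refine ⟨(h.succ_iff (hNβ ▸ hyβ)).2 hy, ?_⟩
      rintro ⟨z, hz, hzy⟩
      exact β.bot_not_lt hz ((h.lt_iff z y).1 hzy).1
    · rintro ⟨hy, -⟩
      exact (h.succ_iff (α.lt_mem _ _ hy.1).2).1 hy

end LPOF

/-! ### Pomsets with formulae -/

/-- Pomsets with formulae: isomorphism classes of labelled partial orders with formulae. -/
def Pom (V : Type*) (L : Type*) [PartialOrder L] [OrderBot L] : Type _ :=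
  Quotient (LPOF.setoid V L)

namespace Pom

variable {V : Type*} {L : Type*} [PartialOrder L] [OrderBot L]

/-- The isomorphism class of `α`. -/
def mk (α : LPOF V L) : Pom V L := Quotient.mk _ α

/-- `α` is a representative of the pomset `A`. -/
def Rep (A : Pom V L) (α : LPOF V L) : Prop := mk α = A

/-- A pomset is finite if it has finitely many nodes. -/
def IsFinite (A : Pom V L) : Prop := ∃ α, A.Rep α ∧ α.nodes.Finite

theorem mk_eq_iff {α β : LPOF V L} : mk α = mk β ↔ LPOF.Iso α β :=
  ⟨fun h => Quotient.exact h, fun h => Quotient.sound h⟩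

theorem exists_le_rep {A B : Pom V L} {α β β' : LPOF V L} (hA : A.Rep α) (hB : B.Rep β)
    (hB' : B.Rep β') (h : α ≤ β) : ∃ α', A.Rep α' ∧ α' ≤ β' := by
  obtain ⟨f, hf, rfl⟩ := mk_eq_iff.1 (hB.trans hB'.symm)
  have hα : Set.InjOn f α.nodes := hf.mono (LPOF.Le.nodes_subset h)
  refine ⟨α.rename f hα, ?_, LPOF.Le.rename h hf hα⟩
  have : mk (α.rename f hα) = mk α := mk_eq_iff.2 (LPOF.Iso.symm ⟨f, hα, rfl⟩)
  exact this.trans hA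

/-- The order on pomsets: `A ≤ B` iff some representative of `A` lies below some representative
of `B`. See `le_iff_forall_exists` and `le_iff_forall_rep` for the equivalent forms with one of
the two representatives arbitrary. -/
instance partialOrder (V : Type*) (L : Type*) [PartialOrder L] [OrderBot L] :
    PartialOrder (Pom V L) where
  le A B := ∃ α β, A.Rep α ∧ B.Rep β ∧ α ≤ β
  le_refl A := by
    obtain ⟨α, hα⟩ := Quotient.exists_rep A
    exact ⟨α, α, hα, hα, le_rfl⟩
  le_trans A B C := by
    rintro ⟨α, β, hα, hβ, h⟩ ⟨β', γ, hβ', hγ, k⟩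
    obtain ⟨α', hα', h'⟩ := exists_le_rep hα hβ hβ' h
    exact ⟨α', γ, hα', hγ, h'.trans k⟩
  le_antisymm A B := by
    rintro ⟨α, β, hα, hβ, h⟩ ⟨β', α', hβ', hα', k⟩
    obtain ⟨α'', hα'', h'⟩ := exists_le_rep hα hβ hβ' h
    have := LPOF.Le.eq_of_iso h' k (mk_eq_iff.1 (hα''.trans hα'.symm))
    rw [← hα'', this]
    exact hβ'

theorem le_iff_forall_rep {A B : Pom V L} : A ≤ B ↔ ∀ β, B.Rep β → ∃ α, A.Rep α ∧ α ≤ β := by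
  constructor
  · rintro ⟨α, β, hα, hβ, h⟩ β' hβ'
    exact exists_le_rep hα hβ hβ' h
  · intro h
    obtain ⟨β, hβ⟩ := Quotient.exists_rep B
    obtain ⟨α, hα, h'⟩ := h β hβ
    exact ⟨α, β, hα, hβ, h'⟩

/-- If the representatives of `A` leave infinitely many nodes unused (as they do when `A` is
finite and `V` is infinite, or when `V` is uncountable), then `A ≤ B` iff every representative
of `A` lies below some representative of `B`. -/
theorem le_iff_forall_exists {A B : Pom V L} (hA : ∀ α, A.Rep α → α.nodesᶜ.Infinite) :
    A ≤ B ↔ ∀ α, A.Rep α → ∃ β, B.Rep β ∧ α ≤ β := by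
  constructor
  · rintro ⟨α, β, hα, hβ, h⟩ α' hα'
    obtain ⟨f, hf, rfl⟩ := mk_eq_iff.1 (hα.trans hα'.symm)
    have : Infinite ((α.rename f hf).nodesᶜ : Set V) := (hA _ hα').to_subtype
    have : Countable β.nodes := β.nodes_countable.to_subtype
    obtain ⟨e, he⟩ := exists_injective_nat β.nodes
    let j : ℕ ↪ ((α.rename f hf).nodesᶜ : Set V) := Infinite.natEmbedding _
    classical
    let g : V → V := fun x =>
      if x ∈ α.nodes then f x else if hx : x ∈ β.nodes then (j (e ⟨x, hx⟩)).1 else x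
    have g1 : ∀ x ∈ α.nodes, g x = f x := fun x hx => if_pos hx
    have g2 : ∀ x (hx : x ∈ β.nodes), x ∉ α.nodes → g x = (j (e ⟨x, hx⟩)).1 := by
      intro x hx hxα
      simp only [g, if_neg hxα, dif_pos hx]
    have hgβ : Set.InjOn g β.nodes := by
      intro x hx y hy hxy
      by_cases hxα : x ∈ α.nodes <;> by_cases hyα : y ∈ α.nodes
      · rw [g1 x hxα, g1 y hyα] at hxy
        exact hf hxα hyα hxy
      · rw [g1 x hxα, g2 y hy hyα] at hxy
        exact absurd ⟨x, hxα, hxy⟩ (j (e ⟨y, hy⟩)).2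
      · rw [g1 y hyα, g2 x hx hxα] at hxy
        exact absurd ⟨y, hyα, hxy.symm⟩ (j (e ⟨x, hx⟩)).2
      · rw [g2 x hx hxα, g2 y hy hyα] at hxy
        exact congrArg Subtype.val (he (j.injective (Subtype.ext hxy)))
    have hgα : Set.InjOn g α.nodes := hgβ.mono (LPOF.Le.nodes_subset h)
    have heq : α.rename g hgα = α.rename f hf := by
      refine LPOF.eq_of (Set.image_congr g1) ?_ ?_ ?_
      · intro x y
        constructor
        · rintro ⟨a, b, hab, rfl, rfl⟩
          exact ⟨a, b, hab, (g1 a (α.lt_mem _ _ hab).1).symm, (g1 b (α.lt_mem _ _ hab).2).symm⟩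
        · rintro ⟨a, b, hab, rfl, rfl⟩
          exact ⟨a, b, hab, g1 a (α.lt_mem _ _ hab).1, g1 b (α.lt_mem _ _ hab).2⟩
      · rintro _ ⟨x, hx, rfl⟩
        rw [LPOF.rename_label α hgα hx, g1 x hx, LPOF.rename_label α hf hx]
      · rintro _ ⟨x, hx, rfl⟩
        rw [LPOF.rename_form α hgα hx, g1 x hx, LPOF.rename_form α hf hx]
        exact NodeForm.rename_congr fun y hy => g1 y (α.form_free_nodes hx hy)
    refine ⟨β.rename g hgβ, ?_, ?_⟩
    · have : mk (β.rename g hgβ) = mk β := mk_eq_iff.2 (LPOF.Iso.symm ⟨g, hgβ, rfl⟩)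
      exact this.trans hβ
    · rw [← heq]
      exact LPOF.Le.rename h hgβ hgα
  · intro h
    obtain ⟨α, hα⟩ := Quotient.exists_rep A
    obtain ⟨β, hβ, h'⟩ := h α hα
    exact ⟨α, β, hα, hβ, h'⟩

end Pom

/-- Finite pomsets, with the order inherited from all pomsets. -/
abbrev FinPom (V : Type*) (L : Type*) [PartialOrder L] [OrderBot L] : Type _ :=
  {A : Pom V L // A.IsFinite}

/-- The finite approximations of a pomset. -/
def finApprox {V : Type*} {L : Type*} [PartialOrder L] [OrderBot L] (A : Pom V L) :
    Set (FinPom V L) :=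
  {B | B.1 ≤ A}

/-- `IsIterSup f A t`: all the suprema in the iterated supremum
`sup_{B₁ ∈ finApprox A₁} ⋯ sup_{Bₙ ∈ finApprox Aₙ} f (B₁, …, Bₙ)` exist, and its value is `t`. -/
def IsIterSup {V : Type*} {L : Type*} [PartialOrder L] [OrderBot L] {T : Type*} [PartialOrder T] :
    {n : ℕ} → ((Fin n → FinPom V L) → T) → (Fin n → Pom V L) → T → Prop
  | 0, f, _, t => t = f Fin.elim0
  | _ + 1, f, A, t => ∃ g : FinPom V L → T,
      (∀ B ∈ finApprox (A 0), IsIterSup (fun C => f (Fin.cons B C)) (Fin.tail A) (g B)) ∧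
      IsLUB (g '' finApprox (A 0)) t

/-! The continuity statement is the usual extension of a monotone map from compact elements; the
work lies in showing that pomsets form a dcpo in which finite pomsets are compact and approximate
everything. The tool is truncation at level `n`: discard all nodes above level `n` and relabel those
of level `n` with `⊥`. Levels are finite, so truncations are finite. They increase with `n`, and
every finite approximation lies below one of them (`IsFinite.exists_le_trunc`). They also determine
the order: if all truncations of `A` lie below `B`, then so does `A` (`le_of_forall_trunc_le`), by a
compactness argument in the style of König's lemma.

Along a chain of LPOFs each truncation is eventually constant (`exists_trunc_eventually_eq`).
Increasing sequences in `L` stabilize, and new nodes can only appear above nodes labelled `⊥`; once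
the labels below level `n` are settled, nothing of level at most `n` can be added. Hence the union
of a chain has finite levels and is again an LPOF (`exists_union`).

In a directed set `D` of pomsets the truncation at each level is therefore constant above some
member of `D`. The stable truncations form an increasing sequence of finite pomsets. Finiteness
leaves fresh nodes, so the sequence lifts to a chain of LPOFs, whose union represents the supremum.
Each truncation of this supremum lies below a member of `D`, so finite pomsets are compact
(`Pom.exists_isLUB`).

Suprema of tuples are componentwise, and compactness passes to tuples since there are finitely many
components. The tuples of finite approximations are directed, so joint suprema exist in `T`;
comparing upper bounds identifies them with the iterated ones, and compactness gives continuity. -/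

namespace LPOF

variable {V : Type*} {L : Type*} [PartialOrder L] [OrderBot L]

/-! ### Levels -/

/-- The level of a node of `α`. -/
noncomputable def lev (α : LPOF V L) (x : V) : ℕ := level α.nodes α.lt x

theorem not_lt_of_mem_minSet (α : LPOF V L) {x y : V} (hx : x ∈ minSet α.nodes α.lt) :
    ¬ α.lt y x :=
  (α.pred_eq_empty_iff x).1 hx.2 y

/-- Sets of predecessors grow strictly along `lt`, so each step of a chain adds at least one. The
bound ensures that the `sSup` in `level` is not a default value. -/
theorem le_ncard_of_mem_chainLengths (α : LPOF V L) :
    ∀ x ∈ α.nodes, ∀ n ∈ chainLengths α.nodes α.lt x, n ≤ {y | α.lt y x}.ncard := by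
  refine α.lt_induction ?_
  rintro x hx ih n ⟨c, h0, hn, hs⟩
  cases n with
  | zero => exact Nat.zero_le _
  | succ n =>
    have hlt : α.lt (c n) x := hn ▸ (hs n n.lt_succ_self).1
    have h1 := ih (c n) hlt n ⟨c, h0, rfl, fun i hi => hs i (by omega)⟩
    have hss : {z | α.lt z (c n)} ⊂ {z | α.lt z x} :=
      ⟨fun z hz => α.lt_trans _ _ _ hz hlt, fun hc => α.lt_irrefl _ (hc hlt)⟩
    have := Set.ncard_lt_ncard hss (α.finitely_preceded x hx)
    omega

theorem bddAbove_chainLengths (α : LPOF V L) {x : V} (hx : x ∈ α.nodes) :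
    BddAbove (chainLengths α.nodes α.lt x) :=
  ⟨_, fun n hn => α.le_ncard_of_mem_chainLengths x hx n hn⟩

theorem succ_mem_chainLengths (α : LPOF V L) {x y : V} {n : ℕ}
    (hn : n ∈ chainLengths α.nodes α.lt x) (hy : y ∈ succSet α.lt x) :
    n + 1 ∈ chainLengths α.nodes α.lt y := by
  obtain ⟨c, h0, hc, hs⟩ := hn
  refine ⟨fun i => if i ≤ n then c i else y, ?_, ?_, ?_⟩
  · simpa using h0
  · simp
  · intro i hi
    rcases Nat.lt_succ_iff_lt_or_eq.1 hi with h | rfl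
    · simpa [h.le, Nat.succ_le_iff.2 h] using hs i h
    · simpa [hc] using hy

theorem chainLengths_nonempty (α : LPOF V L) :
    ∀ x ∈ α.nodes, (chainLengths α.nodes α.lt x).Nonempty := by
  refine α.lt_induction ?_
  intro x hx ih
  by_cases h : predSet α.lt x = ∅
  · exact ⟨0, fun _ => x, ⟨hx, h⟩, rfl, fun i hi => absurd hi (Nat.not_lt_zero i)⟩
  · obtain ⟨y, hy⟩ := Set.nonempty_iff_ne_empty.2 h
    obtain ⟨n, hn⟩ := ih y hy.1
    exact ⟨n + 1, α.succ_mem_chainLengths hn hy⟩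

theorem lev_mem_chainLengths (α : LPOF V L) {x : V} (hx : x ∈ α.nodes) :
    α.lev x ∈ chainLengths α.nodes α.lt x :=
  Nat.sSup_mem (α.chainLengths_nonempty x hx) (α.bddAbove_chainLengths hx)

theorem le_lev (α : LPOF V L) {x : V} (hx : x ∈ α.nodes) {n : ℕ}
    (hn : n ∈ chainLengths α.nodes α.lt x) : n ≤ α.lev x :=
  le_csSup (α.bddAbove_chainLengths hx) hn

theorem lev_lt_of_mem_succSet (α : LPOF V L) {x y : V} (h : y ∈ succSet α.lt x) :
    α.lev x < α.lev y :=
  α.le_lev (α.lt_mem _ _ h.1).2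
    (α.succ_mem_chainLengths (α.lev_mem_chainLengths (α.lt_mem _ _ h.1).1) h)

theorem lev_lt_lev (α : LPOF V L) {x y : V} (h : α.lt x y) : α.lev x < α.lev y := by
  refine α.lt_induction (P := fun y => ∀ x, α.lt x y → α.lev x < α.lev y) ?_ y
    (α.lt_mem _ _ h).2 x h
  intro y hy ih x hxy
  have hfin := α.finitely_preceded y hy
  -- Among the nodes `z` with `x ≤ z < y`, one with the most predecessors has nothing between it and
  -- `y`, so the case of immediate successors applies.
  obtain ⟨z, ⟨hzx, hzy⟩, hmax⟩ := Set.exists_max_image {z | (z = x ∨ α.lt x z) ∧ α.lt z y}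
    (fun z => {w | α.lt w z}.ncard) (hfin.subset fun z hz => hz.2) ⟨x, Or.inl rfl, hxy⟩
  have hsucc : y ∈ succSet α.lt z := by
    refine ⟨hzy, ?_⟩
    rintro ⟨w, hzw, hwy⟩
    have hxw : α.lt x w := hzx.elim (fun e => e ▸ hzw) fun h => α.lt_trans _ _ _ h hzw
    have hss : {v | α.lt v z} ⊂ {v | α.lt v w} :=
      ⟨fun v hv => α.lt_trans _ _ _ hv hzw, fun hc => α.lt_irrefl _ (hc hzw)⟩
    have h1 := Set.ncard_lt_ncard hss (α.finitely_preceded w (α.lt_mem _ _ hwy).1)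
    have h2 := hmax w ⟨Or.inr hxw, hwy⟩
    omega
  have h1 := α.lev_lt_of_mem_succSet hsucc
  rcases hzx with rfl | hxz
  · exact h1
  · exact (ih z hzy x hxz).trans h1

/-- The last node before `x` on a longest chain has level exactly one less; descend from there.
Truncation uses this to find a node of the cut level below every discarded node. -/
theorem exists_lt_lev_eq (α : LPOF V L) {k : ℕ} :
    ∀ x ∈ α.nodes, k < α.lev x → ∃ z, α.lt z x ∧ α.lev z = k := by
  refine α.lt_induction ?_
  intro x hx ih hk
  obtain ⟨c, h0, hn, hs⟩ := α.lev_mem_chainLengths hx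
  obtain ⟨m, hm⟩ : ∃ m, α.lev x = m + 1 := ⟨α.lev x - 1, by omega⟩
  rw [hm] at hn hs
  have hlt : α.lt (c m) x := hn ▸ (hs m m.lt_succ_self).1
  have h1 : m ≤ α.lev (c m) :=
    α.le_lev (α.lt_mem _ _ hlt).1 ⟨c, h0, rfl, fun i hi => hs i (by omega)⟩
  have h2 := α.lev_lt_lev hlt
  by_cases hkm : k = m
  · exact ⟨c m, hlt, by omega⟩
  · obtain ⟨z, hz, hzk⟩ := ih (c m) hlt (by omega)
    exact ⟨z, α.lt_trans _ _ _ hz hlt, hzk⟩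

theorem lev_eq_zero (α : LPOF V L) {x : V} (hx : x ∈ minSet α.nodes α.lt) : α.lev x = 0 := by
  by_contra h
  obtain ⟨z, hz, -⟩ := α.exists_lt_lev_eq x hx.1 (Nat.pos_of_ne_zero h)
  exact α.not_lt_of_mem_minSet hx hz

theorem Le.lev_eq {α β : LPOF V L} (h : Le α β) {x : V} (hx : x ∈ α.nodes) :
    α.lev x = β.lev x :=
  h.level_eq hx

theorem finite_lev_le (α : LPOF V L) (n : ℕ) : {x | x ∈ α.nodes ∧ α.lev x ≤ n}.Finite := by
  refine ((Set.finite_Iic n).biUnion fun k _ => α.level_finite k).subset ?_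
  rintro x ⟨hx, hn⟩
  exact Set.mem_biUnion (Set.mem_Iic.2 hn) ⟨hx, rfl⟩

/-! ### Criteria for the order -/

/-- Nothing in `α` lies above a `⊥`-node of `α`, so the successors removed in the definition of the
order are exactly those outside `α`. The successor condition thus reduces to: every new node lies
above a `⊥`-node of `α`. -/
theorem Le.of_exists_bot_lt {α β : LPOF V L} (hN : α.nodes ⊆ β.nodes)
    (hdown : ∀ x ∈ α.nodes, ∀ y, β.lt y x → y ∈ α.nodes)
    (hlt : ∀ x ∈ α.nodes, ∀ y ∈ α.nodes, α.lt x y ↔ β.lt x y)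
    (hlabel : ∀ x ∈ α.nodes, α.label x ≤ β.label x)
    (hform : ∀ x ∈ α.nodes, α.form x = β.form x)
    (hbot : ∀ y ∈ β.nodes, y ∉ α.nodes → ∃ x ∈ α.botNodes, β.lt x y) : Le α β where
  nodes_subset := hN
  nodes_down := hdown
  lt_iff x y := by
    constructor
    · intro h
      have hm := α.lt_mem _ _ h
      exact ⟨(hlt x hm.1 y hm.2).1 h, hm⟩
    · rintro ⟨h, hx, hy⟩
      exact (hlt x hx y hy).2 h
  label_le := hlabel
  form_eq := hform
  succ_eq x hx := by
    ext y
    constructor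
    · rintro ⟨hxy, hn⟩
      have hy := (α.lt_mem _ _ hxy).2
      refine ⟨⟨(hlt x hx y hy).1 hxy, ?_⟩, ?_⟩
      · rintro ⟨z, hxz, hzy⟩
        have hz := hdown y hy z hzy
        exact hn ⟨z, (hlt x hx z hz).2 hxz, (hlt z hz y hy).2 hzy⟩
      · rintro ⟨z, hz, hzy⟩
        exact α.bot_not_lt hz ((hlt z hz.1 y hy).2 hzy)
    · rintro ⟨⟨hxy, hn⟩, hab⟩
      have hy : y ∈ α.nodes := by
        by_contra hy
        exact hab (hbot y (β.lt_mem _ _ hxy).2 hy)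
      refine ⟨(hlt x hx y hy).2 hxy, ?_⟩
      rintro ⟨z, hxz, hzy⟩
      have hz := (α.lt_mem _ _ hxz).2
      exact hn ⟨z, (hlt x hx z hz).1 hxz, (hlt z hz y hy).1 hzy⟩

theorem Le.lt_iff_of_mem {α β : LPOF V L} (h : Le α β) {x y : V} (hy : y ∈ α.nodes) :
    α.lt x y ↔ β.lt x y := by
  rw [h.lt_iff]
  exact ⟨fun k => k.1, fun k => ⟨k, h.nodes_down y hy x k, hy⟩⟩

/-- Order and formulae of both structures are inherited from `γ`, and the `⊥`-nodes of `α` below the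
nodes it lacks in `γ` also serve in `β`. Only nodes and labels remain to be compared. -/
theorem Le.of_le_of_le {α β γ : LPOF V L} (h : Le α γ) (k : Le β γ) (hN : α.nodes ⊆ β.nodes)
    (hlabel : ∀ x ∈ α.nodes, α.label x ≤ β.label x) : Le α β := by
  refine Le.of_exists_bot_lt hN ?_ ?_ hlabel ?_ ?_
  · intro x hx y hyx
    exact h.nodes_down x hx y ((k.lt_iff _ _).1 hyx).1
  · intro x hx y hy
    rw [h.lt_iff_of_mem hy, k.lt_iff_of_mem (hN hy)]
  · intro x hx
    rw [h.form_eq x hx, k.form_eq x (hN hx)]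
  · intro y hy hyα
    obtain ⟨x, hx, hxy⟩ := h.exists_bot_lt y (k.nodes_subset hy) hyα
    exact ⟨x, hx, (k.lt_iff_of_mem hy).2 hxy⟩

/-- `f` embeds `α` in `β`, see `Pom.mk_le_mk_iff`. -/
structure Emb (α β : LPOF V L) (f : V → V) : Prop where
  injOn : Set.InjOn f α.nodes
  mapsTo : ∀ x ∈ α.nodes, f x ∈ β.nodes
  down : ∀ x ∈ α.nodes, ∀ y, β.lt y (f x) → ∃ z, α.lt z x ∧ f z = y
  map_lt : ∀ x y, α.lt x y → β.lt (f x) (f y)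
  label_le : ∀ x ∈ α.nodes, α.label x ≤ β.label (f x)
  form_eq : ∀ x ∈ α.nodes, (α.form x).rename f = β.form (f x)
  bot_lt : ∀ y ∈ β.nodes, y ∉ f '' α.nodes → ∃ x ∈ α.botNodes, β.lt (f x) y

theorem Emb.lt_iff {α β : LPOF V L} {f : V → V} (e : Emb α β f) {x y : V} (hx : x ∈ α.nodes)
    (hy : y ∈ α.nodes) : α.lt x y ↔ β.lt (f x) (f y) := by
  refine ⟨e.map_lt x y, fun h => ?_⟩
  obtain ⟨z, hz, hzx⟩ := e.down y hy _ h
  rwa [← e.injOn (α.lt_mem _ _ hz).1 hx hzx]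

/-- The conditions of `Emb` concern individual nodes and their predecessors, which makes them easy
to restrict to truncations and to pass to limits. -/
theorem emb_iff {α β : LPOF V L} {f : V → V} :
    Emb α β f ↔ ∃ hf : Set.InjOn f α.nodes, Le (α.rename f hf) β := by
  constructor
  · intro e
    refine ⟨e.injOn, Le.of_exists_bot_lt ?_ ?_ ?_ ?_ ?_ ?_⟩
    · rintro _ ⟨x, hx, rfl⟩
      exact e.mapsTo x hx
    · rintro _ ⟨x, hx, rfl⟩ y hy
      obtain ⟨z, hz, rfl⟩ := e.down x hx y hy
      exact ⟨z, (α.lt_mem _ _ hz).1, rfl⟩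
    · rintro _ ⟨x, hx, rfl⟩ _ ⟨y, hy, rfl⟩
      rw [rename_lt, mapRel_iff α.lt_mem e.injOn hx hy, e.lt_iff hx hy]
    · rintro _ ⟨x, hx, rfl⟩
      rw [rename_label α e.injOn hx]
      exact e.label_le x hx
    · rintro _ ⟨x, hx, rfl⟩
      rw [rename_form α e.injOn hx]
      exact e.form_eq x hx
    · intro y hy hyf
      obtain ⟨x, hx, hxy⟩ := e.bot_lt y hy hyf
      exact ⟨f x, ⟨⟨x, hx.1, rfl⟩, (rename_label α e.injOn hx.1).trans hx.2⟩, hxy⟩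
  · rintro ⟨hf, h⟩
    refine ⟨hf, ?_, ?_, ?_, ?_, ?_, ?_⟩
    · exact fun x hx => h.nodes_subset ⟨x, hx, rfl⟩
    · intro x hx y hy
      have hfx : f x ∈ (α.rename f hf).nodes := ⟨x, hx, rfl⟩
      have := (h.lt_iff_of_mem hfx).2 hy
      exact (mapRel_right α.lt_mem hf hx).1 this
    · intro x y hxy
      exact ((h.lt_iff _ _).1 ⟨x, y, hxy, rfl, rfl⟩).1
    · intro x hx
      rw [← rename_label α hf hx]
      exact h.label_le _ ⟨x, hx, rfl⟩
    · intro x hx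
      rw [← rename_form α hf hx]
      exact h.form_eq _ ⟨x, hx, rfl⟩
    · intro y hy hyf
      obtain ⟨_, ⟨⟨x, hx, rfl⟩, hb⟩, hxy⟩ := h.exists_bot_lt y hy hyf
      exact ⟨x, ⟨hx, (rename_label α hf hx).symm.trans hb⟩, hxy⟩

theorem Emb.lev_eq {α β : LPOF V L} {f : V → V} (e : Emb α β f) {x : V} (hx : x ∈ α.nodes) :
    β.lev (f x) = α.lev x := by
  obtain ⟨hf, h⟩ := emb_iff.1 e
  have hfx : f x ∈ (α.rename f hf).nodes := ⟨x, hx, rfl⟩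
  rw [← h.lev_eq hfx]
  exact level_mapRel α.lt_mem hf hx

end LPOF

/-- The larger representative can always be kept fixed, since the smaller one is renamed into it
without any fresh nodes. So both representatives may be prescribed. -/
theorem Pom.mk_le_mk_iff {V : Type*} {L : Type*} [PartialOrder L] [OrderBot L] {α β : LPOF V L} :
    Pom.mk α ≤ Pom.mk β ↔ ∃ f, LPOF.Emb α β f := by
  constructor
  · intro h
    obtain ⟨α', hα', h'⟩ := le_iff_forall_rep.1 h β rfl
    obtain ⟨f, hf, rfl⟩ := mk_eq_iff.1 hα'.symm
    exact ⟨f, LPOF.emb_iff.2 ⟨hf, h'⟩⟩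
  · rintro ⟨f, e⟩
    obtain ⟨hf, h⟩ := LPOF.emb_iff.1 e
    exact ⟨α.rename f hf, β, mk_eq_iff.2 (LPOF.Iso.symm ⟨f, hf, rfl⟩), rfl, h⟩

namespace LPOF

variable {V : Type*} {L : Type*} [PartialOrder L] [OrderBot L]

/-! ### Truncation -/

open Classical in
/-- The truncation of `α` at level `n`: the nodes of level at most `n`, where those of level `n`
are relabelled with `⊥`. -/
noncomputable def trunc (α : LPOF V L) (n : ℕ) : LPOF V L where
  nodes := {x | x ∈ α.nodes ∧ α.lev x ≤ n}
  lt x y := α.lt x y ∧ α.lev y ≤ n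
  label x := if α.lev x < n then α.label x else ⊥
  form x := if x ∈ α.nodes ∧ α.lev x ≤ n then α.form x else NodeForm.tru
  nodes_countable := α.nodes_countable.mono fun _ hx => hx.1
  lt_mem x y h :=
    ⟨⟨(α.lt_mem _ _ h.1).1, (α.lev_lt_lev h.1).le.trans h.2⟩, (α.lt_mem _ _ h.1).2, h.2⟩
  lt_irrefl x h := α.lt_irrefl x h.1
  lt_trans x y z h k := ⟨α.lt_trans x y z h.1 k.1, k.2⟩
  finitely_preceded x hx := (α.finitely_preceded x hx.1).subset fun _ hy => hy.1
  level_finite _ := (α.finite_lev_le n).subset fun _ hx => hx.1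
  single_rooted := by
    obtain ⟨r, hr, hu⟩ := α.single_rooted
    refine ⟨r, ⟨⟨hr.1, (α.lev_eq_zero hr).trans_le n.zero_le⟩, ?_⟩, ?_⟩
    · exact Set.eq_empty_of_forall_notMem fun y hy => α.not_lt_of_mem_minSet hr hy.1.1
    · rintro x ⟨⟨hx, hn⟩, hp⟩
      refine hu x ⟨hx, Set.eq_empty_of_forall_notMem fun y hy => ?_⟩
      refine Set.notMem_empty y (hp ▸ ⟨⟨hy.1, hn⟩, ?_⟩)
      rintro ⟨z, hz1, hz2⟩
      exact hy.2 ⟨z, hz1.1, hz2.1⟩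
  succ_of_label_bot x hx hl := by
    refine Set.eq_empty_of_forall_notMem fun y hy => ?_
    -- A successor inside the truncation puts `x` strictly below level `n`, so its label was not
    -- overwritten and is `⊥` in `α` already.
    have hlt := α.lev_lt_lev hy.1.1
    rw [if_pos (hlt.trans_le hy.1.2)] at hl
    exact α.bot_not_lt ⟨hx.1, hl⟩ hy.1.1
  form_sat x hx := by
    rw [if_pos (Set.mem_ofPred.1 hx)]
    exact α.form_sat x hx.1
  form_free x hx := by
    rw [if_pos (Set.mem_ofPred.1 hx)]
    exact fun y hy => ⟨α.form_free x hx.1 hy, hx.2⟩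
  form_entails x y h := by
    rw [if_pos ⟨(α.lt_mem _ _ h.1).2, h.2⟩,
      if_pos ⟨(α.lt_mem _ _ h.1).1, (α.lev_lt_lev h.1).le.trans h.2⟩]
    exact α.form_entails x y h.1
  label_default x hx := by
    split_ifs with h
    · exact α.label_default x fun hxα => hx ⟨hxα, h.le⟩
    · rfl
  form_default x hx := if_neg hx

theorem trunc_label_of_lt (α : LPOF V L) {n : ℕ} {x : V} (h : α.lev x < n) :
    (α.trunc n).label x = α.label x :=
  if_pos h

theorem trunc_label_of_le (α : LPOF V L) {n : ℕ} {x : V} (h : n ≤ α.lev x) :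
    (α.trunc n).label x = ⊥ :=
  if_neg h.not_gt

theorem trunc_form (α : LPOF V L) {n : ℕ} {x : V} (h : x ∈ (α.trunc n).nodes) :
    (α.trunc n).form x = α.form x :=
  if_pos h

theorem trunc_label_le (α : LPOF V L) (n : ℕ) (x : V) : (α.trunc n).label x ≤ α.label x := by
  rcases lt_or_ge (α.lev x) n with h | h
  · exact (α.trunc_label_of_lt h).le
  · exact (α.trunc_label_of_le h).trans_le bot_le

theorem finite_nodes_trunc (α : LPOF V L) (n : ℕ) : (α.trunc n).nodes.Finite :=
  α.finite_lev_le n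

theorem trunc_le (α : LPOF V L) (n : ℕ) : α.trunc n ≤ α := by
  refine Le.of_exists_bot_lt (fun x hx => hx.1) ?_ ?_ ?_ ?_ ?_
  · exact fun x hx y hy => ⟨(α.lt_mem _ _ hy).1, (α.lev_lt_lev hy).le.trans hx.2⟩
  · exact fun x _ y hy => ⟨fun h => h.1, fun h => ⟨h, hy.2⟩⟩
  · exact fun x _ => α.trunc_label_le n x
  · exact fun x hx => α.trunc_form hx
  · intro y hy hyn
    -- A discarded node lies above a node of level exactly `n`, which the truncation has relabelled
    -- with `⊥`.
    have hn : n < α.lev y := lt_of_not_ge fun h => hyn ⟨hy, h⟩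
    obtain ⟨x, hxy, hx⟩ := α.exists_lt_lev_eq y hy hn
    exact ⟨x, ⟨⟨(α.lt_mem _ _ hxy).1, hx.le⟩, α.trunc_label_of_le hx.ge⟩, hxy⟩

theorem trunc_le_trunc_right (α : LPOF V L) {m n : ℕ} (h : m ≤ n) : α.trunc m ≤ α.trunc n := by
  refine Le.of_le_of_le (α.trunc_le m) (α.trunc_le n) (fun x hx => ⟨hx.1, hx.2.trans h⟩) ?_
  intro x _
  rcases lt_or_ge (α.lev x) m with hx | hx
  · rw [α.trunc_label_of_lt hx, α.trunc_label_of_lt (hx.trans_le h)]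
  · rw [α.trunc_label_of_le hx]
    exact bot_le

/-- Embeddings preserve levels, so the same function works on truncations. -/
theorem Emb.trunc {α β : LPOF V L} {f : V → V} (e : Emb α β f) (n : ℕ) :
    Emb (α.trunc n) (β.trunc n) f where
  injOn := e.injOn.mono fun _ hx => hx.1
  mapsTo x hx := ⟨e.mapsTo x hx.1, (e.lev_eq hx.1).trans_le hx.2⟩
  down x hx y hy := by
    obtain ⟨z, hz, rfl⟩ := e.down x hx.1 y hy.1
    exact ⟨z, ⟨hz, hx.2⟩, rfl⟩
  map_lt x y h := ⟨e.map_lt x y h.1, (e.lev_eq (α.lt_mem _ _ h.1).2).trans_le h.2⟩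
  label_le x hx := by
    rcases lt_or_ge (α.lev x) n with h | h
    · rw [α.trunc_label_of_lt h, β.trunc_label_of_lt (by rwa [e.lev_eq hx.1])]
      exact e.label_le x hx.1
    · rw [α.trunc_label_of_le h]
      exact bot_le
  form_eq x hx := by
    rw [α.trunc_form hx, β.trunc_form ⟨e.mapsTo x hx.1, (e.lev_eq hx.1).trans_le hx.2⟩]
    exact e.form_eq x hx.1
  bot_lt y hy hyf := by
    obtain ⟨x, hx, hxy⟩ := e.bot_lt y hy.1 (by
      rintro ⟨x, hx, rfl⟩
      exact hyf ⟨x, ⟨hx, (e.lev_eq hx).symm.trans_le hy.2⟩, rfl⟩)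
    have hlt : α.lev x < n := by
      rw [← e.lev_eq hx.1]
      exact (β.lev_lt_lev hxy).trans_le hy.2
    exact ⟨x, ⟨⟨hx.1, hlt.le⟩, (α.trunc_label_of_lt hlt).trans hx.2⟩, hxy, hy.2⟩

theorem Le.emb {α β : LPOF V L} (h : α ≤ β) : Emb α β id :=
  emb_iff.2 ⟨Set.injOn_id _, by
    rw [rename_eq_self α (f := id) _ fun _ _ => rfl]
    exact h⟩

theorem trunc_mono (n : ℕ) : Monotone fun α : LPOF V L => α.trunc n := by
  intro α β h
  obtain ⟨hf, k⟩ := emb_iff.1 ((Le.emb h).trunc n)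
  rw [rename_eq_self _ (f := id) hf fun _ _ => rfl] at k
  exact k

theorem trunc_trunc (α : LPOF V L) {m n : ℕ} (h : m ≤ n) : (α.trunc n).trunc m = α.trunc m := by
  have hlev : ∀ x ∈ (α.trunc n).nodes, (α.trunc n).lev x = α.lev x :=
    fun x hx => Le.lev_eq (α.trunc_le n) hx
  refine le_antisymm (trunc_mono m (α.trunc_le n)) ?_
  refine Le.of_le_of_le (α.trunc_le m) (((α.trunc n).trunc_le m).trans (α.trunc_le n)) ?_ ?_
  · intro x hx
    have hxn : x ∈ (α.trunc n).nodes := ⟨hx.1, hx.2.trans h⟩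
    exact ⟨hxn, (hlev x hxn).trans_le hx.2⟩
  · intro x hx
    have hxn : x ∈ (α.trunc n).nodes := ⟨hx.1, hx.2.trans h⟩
    rcases lt_or_ge (α.lev x) m with hm | hm
    · rw [α.trunc_label_of_lt hm, trunc_label_of_lt _ ((hlev x hxn).trans_lt hm),
        α.trunc_label_of_lt (hm.trans_le h)]
    · rw [α.trunc_label_of_le hm]
      exact bot_le

/-- A node of `β` of level at most `n` missing from `α` would lie above a `⊥`-node of `α` of level
below `n`. That node keeps its label in `β`, where a `⊥`-node has nothing above it. -/
theorem trunc_eq_trunc {α β : LPOF V L} (h : α ≤ β) {n : ℕ}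
    (hlabel : ∀ x ∈ α.nodes, α.lev x < n → α.label x = β.label x) : α.trunc n = β.trunc n := by
  refine le_antisymm (trunc_mono n h) ?_
  refine Le.of_le_of_le (β.trunc_le n) ((α.trunc_le n).trans h) ?_ ?_
  all_goals
    intro x hx
    have hxα : x ∈ α.nodes := by
      by_contra hxα
      obtain ⟨z, hz, hzx⟩ := Le.exists_bot_lt h x hx.1 hxα
      have hzn : α.lev z < n := by
        rw [Le.lev_eq h hz.1]
        exact (β.lev_lt_lev hzx).trans_le hx.2
      exact β.bot_not_lt ⟨h.nodes_subset hz.1, (hlabel z hz.1 hzn).symm.trans hz.2⟩ hzx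
    have hlev := Le.lev_eq h hxα
  · exact ⟨hxα, hlev.trans_le hx.2⟩
  · rcases lt_or_ge (β.lev x) n with hm | hm
    · rw [β.trunc_label_of_lt hm, α.trunc_label_of_lt (hlev.trans_lt hm),
        hlabel x hxα (hlev.trans_lt hm)]
    · rw [β.trunc_label_of_le hm]
      exact bot_le

theorem exists_le_trunc {α β : LPOF V L} (h : α ≤ β) (hfin : α.nodes.Finite) :
    ∃ n, α ≤ β.trunc n := by
  obtain ⟨n, hn⟩ := (hfin.image β.lev).bddAbove
  have hlt : ∀ x ∈ α.nodes, β.lev x < n + 1 := fun x hx => Nat.lt_succ_of_le (hn ⟨x, hx, rfl⟩)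
  -- One level beyond the highest node of `α`, because a truncation erases the labels of its top
  -- level.
  refine ⟨n + 1, Le.of_le_of_le h (β.trunc_le _) ?_ ?_⟩
  · exact fun x hx => ⟨h.nodes_subset hx, (hlt x hx).le⟩
  · intro x hx
    rw [β.trunc_label_of_lt (hlt x hx)]
    exact h.label_le x hx

/-- Embeddings of all truncations of `α` in `β` have a limit along an ultrafilter, which embeds
`α` in `β`. -/
theorem exists_emb_of_forall_trunc {α β : LPOF V L} (h : ∀ n, ∃ f, Emb (α.trunc n) β f) :
    ∃ f, Emb α β f := by
  choose e he using h
  let U : Ultrafilter ℕ := Filter.hyperfilter ℕ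
  have hU : ∀ k, ∀ᶠ n in (U : Filter ℕ), k < n := fun k =>
    (Nat.hyperfilter_le_atTop) (Filter.eventually_gt_atTop k)
  have hlev : ∀ n, ∀ x ∈ (α.trunc n).nodes, β.lev (e n x) = α.lev x := fun n x hx =>
    ((he n).lev_eq hx).trans (Le.lev_eq (α.trunc_le n) hx)
  have hmem : ∀ x ∈ α.nodes, ∀ᶠ n in (U : Filter ℕ), x ∈ (α.trunc n).nodes := fun x hx =>
    (hU (α.lev x)).mono fun n hn => ⟨hx, hn.le⟩
  -- The values `e n x` stay in one finite level of `β`, so the ultrafilter singles out one of them.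
  have hlim : ∀ x, ∃ y, x ∈ α.nodes → ∀ᶠ n in (U : Filter ℕ), e n x = y := by
    intro x
    by_cases hx : x ∈ α.nodes
    · have hev : ∀ᶠ n in (U : Filter ℕ), ∃ y ∈ {y | y ∈ β.nodes ∧ β.lev y = α.lev x}, e n x = y :=
        (hmem x hx).mono fun n hn => ⟨_, ⟨(he n).mapsTo x hn, hlev n x hn⟩, rfl⟩
      obtain ⟨y, -, hy⟩ := (Ultrafilter.eventually_exists_mem_iff (β.level_finite _)).1 hev
      exact ⟨y, fun _ => hy⟩
    · exact ⟨x, fun h => absurd h hx⟩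
  choose f hf using hlim
  refine ⟨f, ?_, ?_, ?_, ?_, ?_, ?_, ?_⟩
  · intro x hx y hy hxy
    obtain ⟨n, h1, h2, h3, h4⟩ :=
      ((hmem x hx).and <| (hmem y hy).and <| (hf x hx).and (hf y hy)).exists
    exact (he n).injOn h1 h2 (h3.trans (hxy.trans h4.symm))
  · intro x hx
    obtain ⟨n, h1, h2⟩ := ((hmem x hx).and (hf x hx)).exists
    exact h2 ▸ (he n).mapsTo x h1
  · intro x hx y hy
    -- There are finitely many predecessors of `x`, so a single `e n` agrees with the limit on all
    -- of them.
    have hall : ∀ᶠ n in (U : Filter ℕ), ∀ z ∈ {z | α.lt z x}, e n z = f z :=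
      (Filter.eventually_all_finite (α.finitely_preceded x hx)).2 fun z hz =>
        hf z (α.lt_mem _ _ hz).1
    obtain ⟨n, h1, h2, h3⟩ := ((hmem x hx).and <| (hf x hx).and hall).exists
    obtain ⟨z, hz, hzy⟩ := (he n).down x h1 y (h2.symm ▸ hy)
    exact ⟨z, hz.1, (h3 z hz.1).symm.trans hzy⟩
  · intro x y hxy
    have hm := α.lt_mem _ _ hxy
    obtain ⟨n, h1, h2, h3⟩ := ((hmem y hm.2).and <| (hf x hm.1).and (hf y hm.2)).exists
    rw [← h2, ← h3]
    exact (he n).map_lt x y ⟨hxy, h1.2⟩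
  · intro x hx
    obtain ⟨n, h1, h2, h3⟩ := ((hmem x hx).and <| (hf x hx).and (hU (α.lev x))).exists
    rw [← h2, ← α.trunc_label_of_lt h3]
    exact (he n).label_le x h1
  · intro x hx
    have hall : ∀ᶠ n in (U : Filter ℕ), ∀ z ∈ {z | α.lt z x}, e n z = f z :=
      (Filter.eventually_all_finite (α.finitely_preceded x hx)).2 fun z hz =>
        hf z (α.lt_mem _ _ hz).1
    obtain ⟨n, h1, h2, h3⟩ := ((hmem x hx).and <| (hf x hx).and hall).exists
    rw [← h2, ← (he n).form_eq x h1, α.trunc_form h1]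
    exact NodeForm.rename_congr fun z hz => (h3 z (α.form_free x hx hz)).symm
  · intro y hy hyf
    -- If `y` is hit for almost all `n`, finitely many candidates of its level force a fixed
    -- preimage, contradicting `hyf`. Otherwise the `⊥`-nodes below `y` also range over a finite
    -- set, and one of them recurs. Taking `n` beyond the level of `y` ensures that its `⊥` comes
    -- from `α` and not from the cut.
    by_cases hev : ∀ᶠ n in (U : Filter ℕ), ∃ x ∈ {x | x ∈ α.nodes ∧ α.lev x = β.lev y}, e n x = y
    · obtain ⟨x, hx, hxy⟩ := (Ultrafilter.eventually_exists_mem_iff (α.level_finite _)).1 hev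
      obtain ⟨n, h1, h2⟩ := (hxy.and (hf x hx.1)).exists
      exact absurd ⟨x, hx.1, h2.symm.trans h1⟩ hyf
    · rw [← Ultrafilter.eventually_not] at hev
      have hev2 : ∀ᶠ n in (U : Filter ℕ), ∃ x ∈ {x | x ∈ α.nodes ∧ α.lev x ≤ β.lev y},
          α.label x = ⊥ ∧ β.lt (e n x) y := by
        filter_upwards [hev, hU (β.lev y)] with n hn hlt
        obtain ⟨x, hx, hxy⟩ := (he n).bot_lt y hy (by
          rintro ⟨x, hx, hxy⟩
          exact hn ⟨x, ⟨hx.1, by rw [← hlev n x hx, hxy]⟩, hxy⟩)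
        have hxl : α.lev x < β.lev y := by
          rw [← hlev n x hx.1]
          exact β.lev_lt_lev hxy
        refine ⟨x, ⟨hx.1.1, hxl.le⟩, ?_, hxy⟩
        rw [← α.trunc_label_of_lt (hxl.trans hlt)]
        exact hx.2
      obtain ⟨x, hx, hev3⟩ :=
        (Ultrafilter.eventually_exists_mem_iff (α.finite_lev_le _)).1 hev2
      obtain ⟨n, h1, h2⟩ := (hev3.and (hf x hx.1)).exists
      exact ⟨x, ⟨hx.1, h1.1⟩, h2 ▸ h1.2⟩

end LPOF

/-! ### Chains -/

/-- The range has a supremum with finitely many elements below it, so the range is finite. -/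
theorem Monotone.exists_eventually_eq {L : Type*} [PartialOrder L] (hLfp : FinitelyPreceded L)
    (hLdcpo : IsDCPO L) {u : ℕ → L} (hu : Monotone u) : ∃ a, ∀ᶠ i in Filter.atTop, u i = a := by
  obtain ⟨s, hs⟩ := hLdcpo (Set.range u) (Set.range_nonempty u) hu.directed_le.directedOn_range
  have hfin : (Set.range u).Finite := by
    refine ((hLfp s).insert s).subset ?_
    intro a ha
    exact (hs.1 ha).eq_or_lt
  obtain ⟨_, ⟨N, rfl⟩, hN⟩ := hfin.exists_maximal (Set.range_nonempty u)
  refine ⟨u N, Filter.eventually_atTop.2 ⟨N, fun i hi => ?_⟩⟩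
  exact (hN ⟨i, rfl⟩ (hu hi)).antisymm (hu hi)

namespace LPOF

variable {V : Type*} {L : Type*} [PartialOrder L] [OrderBot L]

/-- The default label `⊥` outside the node set makes this hold for every `x`, even before it becomes
a node. -/
theorem monotone_label (x : V) : Monotone fun α : LPOF V L => α.label x := by
  intro α β h
  by_cases hx : x ∈ α.nodes
  · exact Le.label_le h x hx
  · simp only [α.label_default x hx, bot_le]

/-! ### Stabilization and unions of increasing sequences of LPOFs -/

section Chain

variable {c : ℕ → LPOF V L}

theorem eventually_mem_nodes (hc : Monotone c) {x : V} {i : ℕ} (hx : x ∈ (c i).nodes) :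
    ∀ᶠ j in Filter.atTop, x ∈ (c j).nodes :=
  (Filter.eventually_ge_atTop i).mono fun _ hj => Le.nodes_subset (hc hj) hx

theorem eventually_lt (hc : Monotone c) {x y : V} {i : ℕ} (h : (c i).lt x y) :
    ∀ᶠ j in Filter.atTop, (c j).lt x y :=
  (Filter.eventually_ge_atTop i).mono fun _ hj => ((Le.lt_iff (hc hj) x y).1 h).1

theorem exists_trunc_eventually_eq (hLfp : FinitelyPreceded L) (hLdcpo : IsDCPO L)
    (hc : Monotone c) (n : ℕ) : ∃ β, ∀ᶠ i in Filter.atTop, (c i).trunc n = β := by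
  induction n with
  | zero =>
    exact ⟨(c 0).trunc 0, Filter.Eventually.of_forall fun i =>
      (trunc_eq_trunc (hc i.zero_le) fun _ _ h => absurd h (Nat.not_lt_zero _)).symm⟩
  | succ n ih =>
    obtain ⟨β, hβ⟩ := ih
    have hlab : ∀ x, ∃ a, ∀ᶠ i in Filter.atTop, (c i).label x = a := fun x =>
      Monotone.exists_eventually_eq hLfp hLdcpo ((monotone_label x).comp hc)
    choose lab hlab using hlab
    have hfin : β.nodes.Finite := by
      obtain ⟨i, rfl⟩ := hβ.exists
      exact (c i).finite_nodes_trunc n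
    -- The nodes of level at most `n` are those of the finite `β`, so from some index on all their
    -- labels are final. These are the labels on which the truncation at `n + 1` depends.
    have hall := hβ.and ((Filter.eventually_all_finite hfin).2 fun x _ => hlab x)
    obtain ⟨N, hN⟩ := Filter.eventually_atTop.1 hall
    refine ⟨(c N).trunc (n + 1), Filter.eventually_atTop.2 ⟨N, fun i hi => ?_⟩⟩
    refine (trunc_eq_trunc (hc hi) fun x hx hxn => ?_).symm
    have hxβ : x ∈ β.nodes := by
      rw [← (hN N le_rfl).1]
      exact ⟨hx, Nat.lt_succ_iff.1 hxn⟩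
    rw [(hN N le_rfl).2 x hxβ, (hN i hi).2 x hxβ]

/-- The union of a chain. -/
theorem exists_union (hLfp : FinitelyPreceded L) (hLdcpo : IsDCPO L) (hc : Monotone c) :
    ∃ γ : LPOF V L, (∀ i, c i ≤ γ) ∧ ∀ n, ∃ i, γ.trunc n = (c i).trunc n := by
  have hlab : ∀ x, ∃ a, ∀ᶠ i in Filter.atTop, (c i).label x = a := fun x =>
    Monotone.exists_eventually_eq hLfp hLdcpo ((monotone_label x).comp hc)
  have hform : ∀ x, ∃ a, ∀ᶠ i in Filter.atTop, (c i).form x = a := by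
    intro x
    by_cases hx : ∃ i, x ∈ (c i).nodes
    · obtain ⟨i, hi⟩ := hx
      exact ⟨(c i).form x, (Filter.eventually_ge_atTop i).mono fun j hj =>
        (Le.form_eq (hc hj) x hi).symm⟩
    · push Not at hx
      exact ⟨NodeForm.tru, Filter.Eventually.of_forall fun i => (c i).form_default x (hx i)⟩
  choose lab hlab using hlab
  choose form hform using hform
  let N : Set V := {x | ∃ i, x ∈ (c i).nodes}
  let R : V → V → Prop := fun x y => ∃ i, (c i).lt x y
  have hN : ∀ x ∈ N, ∀ᶠ i in Filter.atTop, x ∈ (c i).nodes := fun x ⟨_, hi⟩ =>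
    eventually_mem_nodes hc hi
  have hR : ∀ x y, R x y → ∀ᶠ i in Filter.atTop, (c i).lt x y := fun x y ⟨_, hi⟩ =>
    eventually_lt hc hi
  -- The past of a node is complete as soon as the node appears. Predecessors, minimality and levels
  -- in the union can hence be computed at any stage containing the node.
  have hdown : ∀ i, ∀ x ∈ (c i).nodes, ∀ y, R y x → (c i).lt y x := by
    intro i x hx y hyx
    obtain ⟨j, hij, hj⟩ := ((Filter.eventually_ge_atTop i).and (hR y x hyx)).exists
    exact ((hc hij : Le _ _).lt_iff_of_mem hx).2 hj
  have hpred : ∀ i, ∀ x ∈ (c i).nodes, ∀ y, y ∈ predSet R x ↔ y ∈ predSet (c i).lt x := by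
    intro i x hx y
    constructor
    · rintro ⟨h1, h2⟩
      exact ⟨hdown i x hx y h1, fun ⟨z, hz1, hz2⟩ => h2 ⟨z, ⟨i, hz1⟩, ⟨i, hz2⟩⟩⟩
    · rintro ⟨h1, h2⟩
      refine ⟨⟨i, h1⟩, ?_⟩
      rintro ⟨z, hz1, hz2⟩
      have hzx := hdown i x hx z hz2
      exact h2 ⟨z, hdown i z ((c i).lt_mem _ _ hzx).1 y hz1, hzx⟩
  have hmin : ∀ i, ∀ x ∈ (c i).nodes, x ∈ minSet N R ↔ x ∈ minSet (c i).nodes (c i).lt := by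
    intro i x hx
    have : predSet R x = predSet (c i).lt x := Set.ext (hpred i x hx)
    exact and_congr (iff_of_true ⟨i, hx⟩ hx) (by rw [this])
  have hlevel : ∀ i, ∀ x ∈ (c i).nodes, level N R x = (c i).lev x := by
    intro i x hx
    unfold lev level
    congr 1
    ext n
    constructor
    · rintro ⟨d, h0, hn, hs⟩
      have hmem : ∀ k ≤ n, d (n - k) ∈ (c i).nodes := by
        intro k
        induction k with
        | zero => exact fun _ => by rwa [Nat.sub_zero, hn]
        | succ k ih =>
          intro hk
          have h1 := hs (n - (k + 1)) (by omega)
          rw [show n - (k + 1) + 1 = n - k by omega] at h1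
          exact ((c i).lt_mem _ _ (hdown i _ (ih (by omega)) _ h1.1)).1
      have hmem' : ∀ k ≤ n, d k ∈ (c i).nodes := by
        intro k hk
        have := hmem (n - k) (by omega)
        rwa [show n - (n - k) = k by omega] at this
      exact ⟨d, (hmin i _ (hmem' 0 n.zero_le)).1 h0, hn, fun k hk =>
        (hpred i _ (hmem' (k + 1) hk) (d k)).1 (hs k hk)⟩
    · rintro ⟨d, h0, hn, hs⟩
      exact ⟨d, (hmin i _ h0.1).2 h0, hn, fun k hk =>
        (hpred i _ ((c i).lt_mem _ _ (hs k hk).1).2 (d k)).2 (hs k hk)⟩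
  let γ : LPOF V L :=
    { nodes := N
      lt := R
      label := lab
      form := form
      nodes_countable := by
        have : N = ⋃ i, (c i).nodes := by
          ext x
          simp [N]
        rw [this]
        exact Set.countable_iUnion fun i => (c i).nodes_countable
      lt_mem := fun x y ⟨i, hi⟩ =>
        ⟨⟨i, ((c i).lt_mem _ _ hi).1⟩, ⟨i, ((c i).lt_mem _ _ hi).2⟩⟩
      lt_irrefl := fun x ⟨i, hi⟩ => (c i).lt_irrefl x hi
      lt_trans := by
        intro x y z hxy hyz
        obtain ⟨i, h1, h2⟩ := ((hR x y hxy).and (hR y z hyz)).exists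
        exact ⟨i, (c i).lt_trans x y z h1 h2⟩
      finitely_preceded := fun x ⟨i, hi⟩ =>
        ((c i).finitely_preceded x hi).subset fun y hy => hdown i x hi y hy
      level_finite := by
        intro n
        -- All nodes of level `n` in the union lie in the stable truncation, which is finite;
        -- without stabilization a level could grow forever.
        obtain ⟨β, hβ⟩ := exists_trunc_eventually_eq hLfp hLdcpo hc n
        have hfin : β.nodes.Finite := by
          obtain ⟨i, rfl⟩ := hβ.exists
          exact (c i).finite_nodes_trunc n
        refine hfin.subset ?_
        rintro x ⟨hx, hn⟩
        obtain ⟨i, rfl, hi⟩ := (hβ.and (hN x hx)).exists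
        exact ⟨hi, ((hlevel i x hi).symm.trans hn).le⟩
      single_rooted := by
        obtain ⟨r, hr, -⟩ := (c 0).single_rooted
        have hrm : ∀ i, r ∈ minSet (c i).nodes (c i).lt := fun i =>
          Le.minSet_eq (hc i.zero_le) ▸ hr
        refine ⟨r, (hmin 0 r hr.1).2 hr, ?_⟩
        rintro x hx
        obtain ⟨i, hi⟩ := hx.1
        exact (c i).single_rooted.unique ((hmin i x hi).1 hx) (hrm i)
      succ_of_label_bot := by
        intro x hx hl
        refine Set.eq_empty_of_forall_notMem fun y hy => ?_
        obtain ⟨i, h1, h2, h3⟩ := ((hN x hx).and <| (hlab x).and (hR x y hy.1)).exists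
        exact (c i).bot_not_lt ⟨h1, h2.trans hl⟩ h3
      form_sat := by
        intro x hx
        obtain ⟨i, h1, h2⟩ := ((hN x hx).and (hform x)).exists
        exact h2 ▸ (c i).form_sat x h1
      form_free := by
        intro x hx y hy
        obtain ⟨i, h1, h2⟩ := ((hN x hx).and (hform x)).exists
        rw [← h2] at hy
        exact ⟨i, (c i).form_free x h1 hy⟩
      form_entails := by
        intro x y hxy
        obtain ⟨i, h1, h2, h3⟩ := ((hR x y hxy).and <| (hform x).and (hform y)).exists
        rw [← h2, ← h3]
        exact (c i).form_entails x y h1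
      label_default := by
        intro x hx
        obtain ⟨i, h⟩ := (hlab x).exists
        exact h.symm.trans ((c i).label_default x fun hi => hx ⟨i, hi⟩)
      form_default := by
        intro x hx
        obtain ⟨i, h⟩ := (hform x).exists
        exact h.symm.trans ((c i).form_default x fun hi => hx ⟨i, hi⟩) }
  have hle : ∀ i, c i ≤ γ := by
    intro i
    refine Le.of_exists_bot_lt (fun x hx => ⟨i, hx⟩) ?_ ?_ ?_ ?_ ?_
    · exact fun x hx y hy => ((c i).lt_mem _ _ (hdown i x hx y hy)).1
    · exact fun x _ y hy => ⟨fun h => ⟨i, h⟩, hdown i y hy x⟩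
    · intro x _
      obtain ⟨j, hij, hj⟩ := ((Filter.eventually_ge_atTop i).and (hlab x)).exists
      exact (monotone_label x (hc hij)).trans hj.le
    · intro x hx
      obtain ⟨j, hij, hj⟩ := ((Filter.eventually_ge_atTop i).and (hform x)).exists
      exact (Le.form_eq (hc hij) x hx).trans hj
    · intro y hy hyi
      obtain ⟨j, hij, hj⟩ := ((Filter.eventually_ge_atTop i).and (hN y hy)).exists
      obtain ⟨x, hx, hxy⟩ := Le.exists_bot_lt (hc hij) y hj hyi
      exact ⟨x, hx, j, hxy⟩
  refine ⟨γ, hle, fun n => ?_⟩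
  obtain ⟨β, hβ⟩ := exists_trunc_eventually_eq hLfp hLdcpo hc n
  have hfin : {x | x ∈ γ.nodes ∧ γ.lev x ≤ n}.Finite := γ.finite_lev_le n
  -- At this stage the finitely many nodes of level at most `n` have reached their limit labels, so
  -- `trunc_eq_trunc` applies to `c i` and the union.
  obtain ⟨i, hi⟩ := ((Filter.eventually_all_finite hfin).2 fun x _ => hlab x).exists
  refine ⟨i, (trunc_eq_trunc (hle i) fun x hx hxn => ?_).symm⟩
  refine hi x ⟨⟨i, hx⟩, ?_⟩
  rw [← Le.lev_eq (hle i) hx]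
  exact hxn.le

end Chain

end LPOF

/-! ### Pomsets -/

namespace Pom

variable {V : Type*} {L : Type*} [PartialOrder L] [OrderBot L]

theorem mk_mono : Monotone (mk : LPOF V L → Pom V L) :=
  fun α β h => ⟨α, β, rfl, rfl, h⟩

/-- The truncation of a pomset at level `n`. -/
noncomputable def trunc (n : ℕ) : Pom V L → Pom V L :=
  Quotient.lift (fun α => mk (α.trunc n)) fun α β h => by
    have key : ∀ α β : LPOF V L, mk α = mk β → mk (α.trunc n) ≤ mk (β.trunc n) := by
      intro α β h
      obtain ⟨f, e⟩ := mk_le_mk_iff.1 h.le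
      exact mk_le_mk_iff.2 ⟨f, e.trunc n⟩
    have h' : mk α = mk β := Quotient.sound h
    exact le_antisymm (key α β h') (key β α h'.symm)

theorem trunc_mk (n : ℕ) (α : LPOF V L) : trunc n (mk α) = mk (α.trunc n) := rfl

theorem trunc_mono (n : ℕ) : Monotone (trunc n : Pom V L → Pom V L) := by
  rintro ⟨α⟩ ⟨β⟩ h
  obtain ⟨f, e⟩ := mk_le_mk_iff.1 h
  exact mk_le_mk_iff.2 ⟨f, e.trunc n⟩

theorem trunc_le (n : ℕ) (A : Pom V L) : trunc n A ≤ A := by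
  obtain ⟨α⟩ := A
  exact mk_mono (α.trunc_le n)

theorem trunc_le_trunc {m n : ℕ} (h : m ≤ n) (A : Pom V L) : trunc m A ≤ trunc n A := by
  obtain ⟨α⟩ := A
  exact mk_mono (α.trunc_le_trunc_right h)

theorem trunc_trunc {m n : ℕ} (h : m ≤ n) (A : Pom V L) :
    trunc m (trunc n A) = trunc m A := by
  obtain ⟨α⟩ := A
  exact congrArg mk (α.trunc_trunc h)

theorem isFinite_trunc (n : ℕ) (A : Pom V L) : (trunc n A).IsFinite := by
  obtain ⟨α⟩ := A
  exact ⟨α.trunc n, rfl, α.finite_nodes_trunc n⟩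

theorem IsFinite.finite_nodes {A : Pom V L} (hA : A.IsFinite) {α : LPOF V L} (hα : A.Rep α) :
    α.nodes.Finite := by
  obtain ⟨β, hβ, hfin⟩ := hA
  obtain ⟨f, hf, rfl⟩ := mk_eq_iff.1 (hβ.trans hα.symm)
  exact hfin.image f

theorem IsFinite.exists_le_trunc {A B : Pom V L} (hA : A.IsFinite) (h : A ≤ B) :
    ∃ n, A ≤ trunc n B := by
  obtain ⟨α, β, hα, rfl, hαβ⟩ := h
  obtain ⟨n, hn⟩ := LPOF.exists_le_trunc hαβ (hA.finite_nodes hα)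
  exact ⟨n, α, β.trunc n, hα, rfl, hn⟩

/-- The embeddings of the various truncations need not extend one another, which is why a limit has
to be taken. -/
theorem le_of_forall_trunc_le {A B : Pom V L} (h : ∀ n, trunc n A ≤ B) : A ≤ B := by
  obtain ⟨α⟩ := A
  obtain ⟨β⟩ := B
  exact mk_le_mk_iff.2 (LPOF.exists_emb_of_forall_trunc fun n => mk_le_mk_iff.1 (h n))

/-- Extending a fixed representative of `G i` to one of `G (i + 1)` needs unused nodes for the new
events. Finiteness of `G i` provides them. -/
theorem exists_monotone_rep [Infinite V] {G : ℕ → Pom V L} (hG : Monotone G)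
    (hfin : ∀ i, (G i).IsFinite) :
    ∃ c : ℕ → LPOF V L, Monotone c ∧ ∀ i, mk (c i) = G i := by
  have hstep : ∀ i (α : {α : LPOF V L // (G i).Rep α}),
      ∃ β : {β : LPOF V L // (G (i + 1)).Rep β}, α.1 ≤ β.1 := by
    rintro i ⟨α, hα⟩
    obtain ⟨β, hβ, h⟩ := (le_iff_forall_exists fun α hα =>
      ((hfin i).finite_nodes hα).infinite_compl).1 (hG i.le_succ) α hα
    exact ⟨⟨β, hβ⟩, h⟩
  choose next hnext using hstep
  obtain ⟨α, hα⟩ := Quotient.exists_rep (G 0)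
  let c : ∀ i, {α : LPOF V L // (G i).Rep α} := fun i => Nat.rec ⟨α, hα⟩ next i
  exact ⟨fun i => (c i).1, monotone_nat_of_le_succ fun i => hnext i (c i), fun i => (c i).2⟩

/-- In a directed set of pomsets, all truncations stabilize. -/
theorem exists_forall_trunc_eq [Infinite V] (hLfp : FinitelyPreceded L) (hLdcpo : IsDCPO L)
    {D : Set (Pom V L)} (hne : D.Nonempty) (n : ℕ) :
    ∃ A ∈ D, ∀ B ∈ D, A ≤ B → trunc n B = trunc n A := by
  by_contra! h
  have h' : ∀ A : D, ∃ B : D, A ≤ B ∧ trunc n B.1 ≠ trunc n A.1 := by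
    rintro ⟨A, hA⟩
    obtain ⟨B, hB, h1, h2⟩ := h A hA
    exact ⟨⟨B, hB⟩, h1, h2⟩
  choose next hle hne' using h'
  obtain ⟨A₀, hA₀⟩ := hne
  -- An increasing sequence whose truncation changes at every step. Its truncations are finite, so
  -- they lift to a chain of LPOFs, where stabilization gives a contradiction.
  let a : ℕ → D := fun i => next^[i] ⟨A₀, hA₀⟩
  have ha : ∀ i, a (i + 1) = next (a i) := fun i => Function.iterate_succ_apply' _ _ _
  have hmono : Monotone a := monotone_nat_of_le_succ fun i => (ha i).symm ▸ hle (a i)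
  obtain ⟨c, hc, hcG⟩ := exists_monotone_rep (G := fun i => trunc n (a i).1)
    (fun i j hij => trunc_mono n (hmono hij)) fun i => isFinite_trunc n _
  obtain ⟨β, hβ⟩ := LPOF.exists_trunc_eventually_eq hLfp hLdcpo hc n
  have hβ' : ∀ᶠ i in Filter.atTop, trunc n (a i).1 = mk β := by
    filter_upwards [hβ] with i hi
    rw [← hi, ← trunc_mk, hcG, trunc_trunc le_rfl]
  obtain ⟨N, hN⟩ := Filter.eventually_atTop.1 hβ'
  refine hne' (a N) ?_
  rw [← ha, hN N le_rfl, hN (N + 1) N.le_succ]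

/-- Directed sets of pomsets have suprema, and finite pomsets are compact. -/
theorem exists_isLUB [Infinite V] (hLfp : FinitelyPreceded L) (hLdcpo : IsDCPO L)
    {D : Set (Pom V L)} (hne : D.Nonempty) (hD : DirectedOn (· ≤ ·) D) :
    ∃ S, IsLUB D S ∧ ∀ B : Pom V L, B.IsFinite → B ≤ S → ∃ A ∈ D, B ≤ A := by
  choose A hAD hA using exists_forall_trunc_eq hLfp hLdcpo hne
  have hG : Monotone fun n => trunc n (A n) := by
    refine monotone_nat_of_le_succ fun n => ?_
    -- Above both `A n` and `A (n + 1)`, the stable truncations are two truncations of one pomset.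
    obtain ⟨B, hB, h1, h2⟩ := hD (A n) (hAD n) (A (n + 1)) (hAD (n + 1))
    rw [← hA n B hB h1, ← hA (n + 1) B hB h2]
    exact trunc_le_trunc n.le_succ B
  obtain ⟨c, hc, hcG⟩ := exists_monotone_rep hG fun n => isFinite_trunc n _
  obtain ⟨γ, hcγ, hγ⟩ := LPOF.exists_union hLfp hLdcpo hc
  -- This yields both minimality of the upper bound `mk γ` and compactness of finite pomsets.
  have htr : ∀ n, ∃ B ∈ D, trunc n (mk γ) ≤ B := by
    intro n
    obtain ⟨i, hi⟩ := hγ n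
    refine ⟨A i, hAD i, ?_⟩
    rw [trunc_mk, hi, ← trunc_mk, hcG]
    exact (trunc_le n _).trans (trunc_le i _)
  refine ⟨mk γ, ⟨?_, ?_⟩, ?_⟩
  · intro B hB
    refine le_of_forall_trunc_le fun n => ?_
    obtain ⟨C, hC, h1, h2⟩ := hD (A n) (hAD n) B hB
    calc trunc n B ≤ trunc n C := trunc_mono n h2
      _ = mk (c n) := by rw [hA n C hC h1, hcG]
      _ ≤ mk γ := mk_mono (hcγ n)
  · intro B hB
    refine le_of_forall_trunc_le fun n => ?_
    obtain ⟨C, hC, h⟩ := htr n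
    exact h.trans (hB hC)
  · intro B hB h
    obtain ⟨n, hn⟩ := hB.exists_le_trunc h
    obtain ⟨C, hC, h'⟩ := htr n
    exact ⟨C, hC, hn.trans h'⟩

/-! ### Directedness of finite approximations -/

theorem finApprox_nonempty (A : Pom V L) : (finApprox A).Nonempty :=
  ⟨⟨trunc 0 A, isFinite_trunc 0 A⟩, trunc_le 0 A⟩

/-- The truncations of `A` form a chain that is cofinal among its finite approximations. -/
theorem directedOn_finApprox (A : Pom V L) : DirectedOn (· ≤ ·) (finApprox A) := by
  rintro ⟨B, hB⟩ hBA ⟨C, hC⟩ hCA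
  obtain ⟨m, hm⟩ := hB.exists_le_trunc hBA
  obtain ⟨n, hn⟩ := hC.exists_le_trunc hCA
  exact ⟨⟨trunc (max m n) A, isFinite_trunc _ A⟩, trunc_le _ A,
    hm.trans (trunc_le_trunc (le_max_left m n) A), hn.trans (trunc_le_trunc (le_max_right m n) A)⟩

end Pom

/-! ### The extension lemma -/

section Extension

variable {V : Type*} {L : Type*} [PartialOrder L] [OrderBot L] {T : Type*} [PartialOrder T]

/-- The tuples of finite approximations of `A`. -/
def finApproxPi {n : ℕ} (A : Fin n → Pom V L) : Set (Fin n → FinPom V L) :=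
  {B | ∀ i, B i ∈ finApprox (A i)}

theorem exists_isLUB_image_finApproxPi (hT : IsDCPO T) {n : ℕ} {f : (Fin n → FinPom V L) → T}
    (hf : Monotone f) (A : Fin n → Pom V L) : ∃ t, IsLUB (f '' finApproxPi A) t := by
  choose B hB using fun i => Pom.finApprox_nonempty (A i)
  refine hT _ ⟨f B, B, hB, rfl⟩ ?_
  rintro _ ⟨C, hC, rfl⟩ _ ⟨D, hD, rfl⟩
  choose E hE hCE hDE using fun i => Pom.directedOn_finApprox (A i) (C i) (hC i) (D i) (hD i)
  exact ⟨f E, ⟨E, hE, rfl⟩, hf hCE, hf hDE⟩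

theorem cons_mem_finApproxPi {n : ℕ} {A : Fin (n + 1) → Pom V L} {B : FinPom V L}
    {C : Fin n → FinPom V L} :
    (Fin.cons B C : Fin (n + 1) → FinPom V L) ∈ finApproxPi A ↔
      B ∈ finApprox (A 0) ∧ C ∈ finApproxPi (Fin.tail A) :=
  Fin.forall_fin_succ

/-- The two sets have the same upper bounds, so existence of either supremum gives the other. -/
theorem isLUB_image_finApproxPi_succ {n : ℕ} {f : (Fin (n + 1) → FinPom V L) → T}
    {A : Fin (n + 1) → Pom V L} {g : FinPom V L → T} {t : T}
    (hg : ∀ B ∈ finApprox (A 0),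
      IsLUB ((fun C => f (Fin.cons B C)) '' finApproxPi (Fin.tail A)) (g B)) :
    IsLUB (g '' finApprox (A 0)) t ↔ IsLUB (f '' finApproxPi A) t := by
  have : upperBounds (g '' finApprox (A 0)) = upperBounds (f '' finApproxPi A) := by
    ext s
    constructor
    · rintro hs _ ⟨B, hB, rfl⟩
      rw [← Fin.cons_self_tail B, cons_mem_finApproxPi] at hB
      rw [← Fin.cons_self_tail B]
      exact ((hg _ hB.1).1 ⟨_, hB.2, rfl⟩).trans (hs ⟨_, hB.1, rfl⟩)
    · rintro hs _ ⟨B, hB, rfl⟩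
      refine (hg B hB).2 ?_
      rintro _ ⟨C, hC, rfl⟩
      exact hs ⟨_, cons_mem_finApproxPi.2 ⟨hB, hC⟩, rfl⟩
  rw [IsLUB, IsLUB, this]

/-- Iterated suprema are joint suprema. -/
theorem isIterSup_iff_isLUB (hT : IsDCPO T) {n : ℕ} {f : (Fin n → FinPom V L) → T}
    (hf : Monotone f) (A : Fin n → Pom V L) (t : T) :
    IsIterSup f A t ↔ IsLUB (f '' finApproxPi A) t := by
  induction n generalizing t with
  | zero =>
    have : finApproxPi A = {Fin.elim0} :=
      Set.eq_singleton_iff_unique_mem.2 ⟨fun i => i.elim0, fun B _ => funext fun i => i.elim0⟩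
    rw [this, Set.image_singleton, IsIterSup]
    constructor
    · rintro rfl
      exact isLUB_singleton
    · exact fun h => h.unique isLUB_singleton
  | succ n ih =>
    have hmono : ∀ B, Monotone fun C => f (Fin.cons B C) := fun B C D h =>
      hf (Fin.cons_le_cons.2 ⟨le_rfl, h⟩)
    constructor
    · rintro ⟨g, hg, ht⟩
      exact (isLUB_image_finApproxPi_succ fun B hB => (ih (hmono B) _ _).1 (hg B hB)).1 ht
    · intro ht
      -- With the first argument fixed, the inner joint supremum exists for every finite `B`, since
      -- `T` is a dcpo.
      choose g hg using fun B => exists_isLUB_image_finApproxPi hT (hmono B) (Fin.tail A)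
      exact ⟨g, fun B _ => (ih (hmono B) _ _).2 (hg B),
        (isLUB_image_finApproxPi_succ fun B _ => hg B).2 ht⟩

/-- Each component of a finite tuple below the supremum lies below that of some member of `D`. There
are finitely many components, so directedness yields one member for all of them; for `n = 0` it
exists because `D` is nonempty. -/
theorem exists_isLUB_pi [Infinite V] (hLfp : FinitelyPreceded L) (hLdcpo : IsDCPO L) {n : ℕ}
    {D : Set (Fin n → Pom V L)} (hne : D.Nonempty) (hD : DirectedOn (· ≤ ·) D) :
    ∃ S, IsLUB D S ∧ ∀ B ∈ finApproxPi S, ∃ A ∈ D, B ∈ finApproxPi A := by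
  have hproj : ∀ i, DirectedOn (· ≤ ·) (Function.eval i '' D) := by
    rintro i _ ⟨A, hA, rfl⟩ _ ⟨B, hB, rfl⟩
    obtain ⟨C, hC, h1, h2⟩ := hD A hA B hB
    exact ⟨_, ⟨C, hC, rfl⟩, h1 i, h2 i⟩
  choose S hS hcomp using fun i => Pom.exists_isLUB hLfp hLdcpo (hne.image (Function.eval i))
    (hproj i)
  refine ⟨S, isLUB_pi.2 hS, fun B hB => ?_⟩
  have hex : ∀ i, ∃ A : D, (B i).1 ≤ A.1 i := by
    intro i
    obtain ⟨_, ⟨A, hA, rfl⟩, h⟩ := hcomp i (B i).1 (B i).2 (hB i)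
    exact ⟨⟨A, hA⟩, h⟩
  choose A hA using hex
  have : Nonempty D := hne.to_subtype
  obtain ⟨C, hC⟩ := (directedOn_iff_directed.1 hD).finite_le A
  exact ⟨C.1, C.2, fun i => (hA i).trans (hC i i)⟩

end Extension

theorem mainTheorem4 {V : Type*} [Infinite V] {L : Type*} [PartialOrder L] [OrderBot L]
    (hLfp : FinitelyPreceded L) (hLdcpo : IsDCPO L)
    {T : Type*} [PartialOrder T] (hT : IsDCPO T)
    (n : ℕ) (f : (Fin n → FinPom V L) → T) (hf : Monotone f) :
    IsDCPO (Fin n → Pom V L) ∧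
    ∃ fstar : (Fin n → Pom V L) → T,
      (∀ (A : Fin n → Pom V L) (t : T), IsIterSup f A t ↔ t = fstar A) ∧
      (∀ A : Fin n → Pom V L, IsLUB (f '' {B | ∀ i, B i ∈ finApprox (A i)}) (fstar A)) ∧
      ScottContinuous fstar := by
  refine ⟨fun D hne hD => ?_, ?_⟩
  · obtain ⟨S, hS, -⟩ := exists_isLUB_pi hLfp hLdcpo hne hD
    exact ⟨S, hS⟩
  choose fstar hfstar using exists_isLUB_image_finApproxPi hT hf
  refine ⟨fstar, fun A t => ?_, hfstar, ?_⟩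
  · rw [isIterSup_iff_isLUB hT hf]
    exact ⟨fun h => h.unique (hfstar A), fun h => h ▸ hfstar A⟩
  · intro D hne hD S hS
    obtain ⟨S', hS', hcomp⟩ := exists_isLUB_pi hLfp hLdcpo hne hD
    obtain rfl := hS.unique hS'
    constructor
    · rintro _ ⟨A, hA, rfl⟩
      refine (hfstar A).2 ?_
      rintro _ ⟨B, hB, rfl⟩
      exact (hfstar S).1 ⟨B, fun i => le_trans (hB i) (hS.1 hA i), rfl⟩
    · intro t ht
      refine (hfstar S).2 ?_
      rintro _ ⟨B, hB, rfl⟩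
      -- By compactness every value contributing to `fstar S` already contributes to `fstar A` for
      -- some `A` in `D`.
      obtain ⟨A, hA, hBA⟩ := hcomp B hB
      exact ((hfstar A).1 ⟨B, hBA, rfl⟩).trans (ht ⟨A, hA, rfl⟩)
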